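/- Let $n \ge 1$ be an integer, $N = n+1$, and $\gamma \in (0,1)$. Write points of $\mathbb{R}^N$ as $x = (\bar x, x_N)$ with $\bar x \in \mathbb{R}^n$, and set $\mathbb{R}^N_+ = \{x_N > 0\}$, $\mathbb{S}^n_+ = \mathbb{S}^n \cap \mathbb{R}^N_+$, with points $\theta = (\bar\theta,\theta_N)$. Let $H^{1,2}_0(\mathbb{S}^n_+;\theta_N^{1-2\gamma})$ be the closure of $C_c^\infty(\mathbb{S}^n_+)$ in the weighted Sobolev space $H^{1,2}(\mathbb{S}^n_+;\theta_N^{1-2\gamma})$ of real functions which, together with their weak gradient, are square integrable for the measure $\theta_N^{1-2\gamma}\,dv_{g_{\mathbb{S}^n}}$. A number $\lambda \in \mathbb{R}$ is called an eigenvalue of the weighted Laplacian $-\mathrm{div}_{g_{\mathbb{S}^n}}(\theta_N^{1-2\gamma}\nabla_{g_{\mathbb{S}^n}}\,\cdot\,)$ with Dirichlet boundary condition on $\partial\mathbb{S}^n_+$, and $Y$ an eigenfunction for it, if $0 \ne Y \in H^{1,2}_0(\mathbb{S}^n_+;\theta_N^{1-2\gamma})$ and \[-\mathrm{div}_{g_{\mathbb{S}^n}}\left(\theta_N^{1-2\gamma}\nabla_{g_{\mathbb{S}^n}}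 Y\right) = \lambda\, \theta_N^{1-2\gamma}\, Y \quad \text{weakly in } \mathbb{S}^n_+ .\] Then the set of all eigenvalues is \[\{(\ell+2\gamma)(\ell+n) : \ell = 0,1,2,\ldots\}.\] Moreover, if $Y$ is an eigenfunction for the eigenvalue $(\ell+2\gamma)(\ell+n)$, then $Y$ agrees almost everywhere on $\mathbb{S}^n_+$ with the restriction of a function $U$ on $\overline{\mathbb{R}^N_+}$, smooth in $\mathbb{R}^N_+$ and continuous on $\overline{\mathbb{R}^N_+}$, such that \[-\mathrm{div}\left(x_N^{1-2\gamma}\nabla U\right) = 0 \ \text{ in } \mathbb{R}^N_+, \qquad U = 0 \ \text{ on } \{x_N = 0\} = \mathbb{R}^n,\] and \[U(x) = \sum_{\substack{k,m \ge 0 \\ k+2m=\ell}} x_N^{2(\gamma+m)}\, p_k(\bar x) \quad \text{for all } x = (\bar x,x_N) \in \mathbb{R}^N_+,\] where each $p_k$ is a (possibly zero) homogeneous real polynomial of degree $k$ in $\bar x \in \mathbb{R}^n$. -/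

import Mathlib

open MeasureTheory Filter Topology Set Metric
open scoped ContDiff ENNReal

noncomputable section

namespace WeightedHemisphere

/-- The Euclidean space `ℝ^N` with `N = n + 1`. -/
abbrev E (n : ℕ) : Type := EuclideanSpace ℝ (Fin (n + 1))

/-- The unit sphere `S^n` of `ℝ^N`. -/
abbrev Sph (n : ℕ) : Type := sphere (0 : E n) 1

/-- The last coordinate `x_N` of a point `x` of `ℝ^N`. -/
def lastCoord {n : ℕ} (x : E n) : ℝ := x (Fin.last n)

/-- The first `n` coordinates `x̄` of `x = (x̄, x_N)`. -/
def initCoord {n : ℕ} (x : E n) : Fin n → ℝ := fun i => x i.castSucc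

/-- The open upper half-space `ℝ^N_+`. -/
def upperHalf (n : ℕ) : Set (E n) := {x | 0 < lastCoord x}

/-- The open upper hemisphere `S^n_+`. -/
def hemisphere (n : ℕ) : Set (Sph n) := {θ | 0 < lastCoord (θ : E n)}

/-- The Riemannian (surface) measure of the round metric on the upper hemisphere,
as a measure on the sphere carried by the hemisphere. -/
def hemiMeasure (n : ℕ) : Measure (Sph n) :=
  ((volume : Measure (E n)).toSphere).restrict (hemisphere n)

/-- The weighted measure `θ_N^{1-2γ} dv` on the upper hemisphere. -/
def weightedMeasure (n : ℕ) (γ : ℝ) : Measure (Sph n) :=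
  (hemiMeasure n).withDensity
    (fun θ => ENNReal.ofReal (lastCoord (θ : E n) ^ (1 - 2 * γ)))

/-- The Euclidean divergence of a vector field on `ℝ^N`. -/
def euclDiv {n : ℕ} (X : E n → E n) (x : E n) : ℝ :=
  ∑ i : Fin (n + 1), (fderiv ℝ X x (EuclideanSpace.single i 1)) i

/-- The gradient on the sphere, at a point `x` of the sphere, of the restriction of an ambient
function `f`: the orthogonal projection of the Euclidean gradient onto the tangent space. -/
def sphereGrad {n : ℕ} (f : E n → ℝ) (x : E n) : E n :=
  gradient f x - (inner ℝ (gradient f x) x) • x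

/-- The divergence on the sphere, at a point `x` of the sphere, of an ambient vector field `X`
which is tangent to the sphere: the trace of `DX` over the tangent space. -/
def sphereDiv {n : ℕ} (X : E n → E n) (x : E n) : ℝ :=
  euclDiv X x - inner ℝ (fderiv ℝ X x x) x

/-- Smooth functions with compact support in the open upper half-space. Their restrictions to the
sphere are exactly the elements of `C_c^∞(S^n_+)`. -/
structure IsTestFunction {n : ℕ} (φ : E n → ℝ) : Prop where
  smooth : ContDiff ℝ ∞ φ
  compact : HasCompactSupport φ
  support : tsupport φ ⊆ upperHalf n

/-- Smooth ambient vector fields with compact support in the open upper half-space which are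
tangent to the sphere. Their restrictions to the sphere are exactly the smooth tangential vector
fields with compact support in `S^n_+`. -/
structure IsTestField {n : ℕ} (X : E n → E n) : Prop where
  smooth : ContDiff ℝ ∞ X
  compact : HasCompactSupport X
  support : tsupport X ⊆ upperHalf n
  tangent : ∀ θ : Sph n, inner ℝ (X θ) (θ : E n) = 0

/-- The tangential vector field `G` is the weak gradient of `u` on `S^n_+`:
`∫ ⟨G, X⟩ dv = - ∫ u div X dv` for every smooth compactly supported tangential field `X`. -/
structure IsWeakGradient {n : ℕ} (u : Sph n → ℝ) (G : Sph n → E n) : Prop where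
  tangent : ∀ᵐ θ ∂(hemiMeasure n), inner ℝ (G θ) (θ : E n) = 0
  byParts : ∀ X : E n → E n, IsTestField X →
    ∫ θ, inner ℝ (G θ) (X θ) ∂(hemiMeasure n)
      = - ∫ θ, u θ * sphereDiv X θ ∂(hemiMeasure n)

/-- `u` belongs to the weighted Sobolev space `H^{1,2}(S^n_+; θ_N^{1-2γ})`, and `G` is its weak
gradient. -/
structure MemH12 {n : ℕ} (γ : ℝ) (u : Sph n → ℝ) (G : Sph n → E n) : Prop where
  memLp : MemLp u 2 (weightedMeasure n γ)
  memLp_grad : MemLp G 2 (weightedMeasure n γ)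
  weakGrad : IsWeakGradient u G

/-- `u` belongs to `H^{1,2}_0(S^n_+; θ_N^{1-2γ})`, the closure of `C_c^∞(S^n_+)` in
`H^{1,2}(S^n_+; θ_N^{1-2γ})`, and `G` is its weak gradient. -/
structure MemH12Zero {n : ℕ} (γ : ℝ) (u : Sph n → ℝ) (G : Sph n → E n) : Prop
    extends MemH12 γ u G where
  approx : ∃ φ : ℕ → E n → ℝ, (∀ j, IsTestFunction (φ j)) ∧
    Tendsto (fun j => eLpNorm (fun θ : Sph n => φ j θ - u θ) 2 (weightedMeasure n γ))
      atTop (𝓝 0) ∧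
    Tendsto (fun j => eLpNorm (fun θ : Sph n => sphereGrad (φ j) θ - G θ) 2
      (weightedMeasure n γ)) atTop (𝓝 0)

/-- `Y` is an eigenfunction with eigenvalue `lam` of the weighted Laplacian with Dirichlet boundary
condition: `Y` is a nonzero element of `H^{1,2}_0(S^n_+; θ_N^{1-2γ})` which solves
`-div(θ_N^{1-2γ} ∇Y) = lam θ_N^{1-2γ} Y` weakly in `S^n_+`. -/
def IsDirichletEigenfunction {n : ℕ} (γ lam : ℝ) (Y : Sph n → ℝ) : Prop :=
  ¬ (Y =ᵐ[weightedMeasure n γ] 0) ∧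
  ∃ G : Sph n → E n, MemH12Zero γ Y G ∧
    ∀ φ : E n → ℝ, IsTestFunction φ →
      ∫ θ : Sph n, inner ℝ (G θ) (sphereGrad φ θ) ∂(weightedMeasure n γ)
        = lam * ∫ θ : Sph n, Y θ * φ θ ∂(weightedMeasure n γ)

/-- The set of all Dirichlet eigenvalues of the weighted Laplacian on `S^n_+`. -/
def dirichletSpectrum (n : ℕ) (γ : ℝ) : Set ℝ :=
  {lam | ∃ Y : Sph n → ℝ, IsDirichletEigenfunction γ lam Y}

/-- `U` is a (classical) solution of `-div(x_N^{1-2γ} ∇U) = 0` in `ℝ^N_+`, `U = 0` on `ℝ^n`: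
smooth in the open half-space, and continuous up to the boundary `x_N = 0`, where it vanishes. -/
structure IsExtensionSolution {n : ℕ} (γ : ℝ) (U : E n → ℝ) : Prop where
  smooth : ContDiffOn ℝ ∞ U (upperHalf n)
  continuous : ContinuousOn U {x | 0 ≤ lastCoord x}
  equation : ∀ x ∈ upperHalf n,
    - euclDiv (fun y => (lastCoord y ^ (1 - 2 * γ)) • gradient U y) x = 0
  boundary : ∀ x : E n, lastCoord x = 0 → U x = 0

/-- The function `∑_{k + 2m = ℓ} x_N^{2(γ+m)} p_k(x̄)`. -/
def homogeneousSum {n : ℕ} (γ : ℝ) (ℓ : ℕ) (p : ℕ → MvPolynomial (Fin n) ℝ) (x : E n) : ℝ :=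
  ∑ q ∈ (Finset.range (ℓ + 1) ×ˢ Finset.range (ℓ + 1)).filter (fun q => q.1 + 2 * q.2 = ℓ),
    lastCoord x ^ (2 * (γ + (q.2 : ℝ))) * MvPolynomial.eval (initCoord x) (p q.1)

end WeightedHemisphere

end

namespace WeightedHemisphere

/-! ### Integration on the sphere -/

/-! The eigenfunctions are written down explicitly, and a completeness argument shows that there are
no others; neither compactness nor regularity theory enters.

Substituting U = x_N^{2γ} F, the flux x_N^{1-2γ} ∇U becomes the polynomial field 2γ F e_N + x_N ∇F,
so the weighted Laplace equation reads x_N ΔF + (1+2γ) ∂_N F = 0. For every homogeneous p(x̄) of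
degree ℓ a two-term recursion gives a solution F = ∑ d_j |x|^{2j} Δ^j p with d_0 = 1
(`extPoly_equation`). Then U is homogeneous of degree ℓ + 2γ, and splitting the divergence-free flux
into radial and tangential parts produces the eigenvalue (ℓ+2γ)(ℓ+n) on the sphere
(`sphereDiv_tangentFlux`). With the divergence theorem on the sphere this becomes the weak equation;
cutting off near the equator puts U in the closure of the test functions (`memH12Zero_extSol`).

Completeness rests on |x| = 1: on the sphere F equals p plus a polynomial in x̄ of lower degree, so
by triangularity these F span all polynomials in x̄. Those are uniformly dense on the closed
hemisphere by Stone–Weierstrass, because there x̄ determines x_N ≥ 0. Hence the functions U are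
total in weighted L² (`ae_eq_zero_of_forall_extSol`).

Weak solutions for distinct eigenvalues are orthogonal, since each may be tested against the other.
A solution for a number outside the list is therefore orthogonal to a total family and vanishes. A
solution for (ℓ+2γ)(ℓ+n), minus its projection on the finite-dimensional space of explicit solutions
of degree ℓ, vanishes for the same reason. Expanding |x|^{2j} = (|x̄|² + x_N²)^j gives the stated
form of U. -/

theorem finrank_E_sub_one (n : ℕ) : Module.finrank ℝ (E n) - 1 = n := by simp

/-- Polar coordinates for a function that separates into angular and radial factors. No
integrability is assumed: the product formula for integrals holds with the default value 0 as well.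
-/
theorem integral_eq_toSphere_mul {n : ℕ} {f : E n → ℝ} {g : ℝ → ℝ} {h : Sph n → ℝ}
    (hf : ∀ (θ : Sph n) (r : ℝ), 0 < r → f (r • (θ : E n)) = h θ * g r) :
    ∫ x, f x = (∫ θ, h θ ∂(volume : Measure (E n)).toSphere)
      * ∫ r : Ioi (0 : ℝ), g r ∂(Measure.volumeIoiPow n) := by
  have h1 : ∫ x, f x = ∫ x : ({(0 : E n)}ᶜ : Set (E n)), f x
      ∂((volume : Measure (E n)).comap (↑)) := by
    rw [integral_subtype_comap (measurableSet_singleton _).compl f, restrict_compl_singleton]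
  rw [h1, ← integral_prod_mul]
  have h2 := (volume : Measure (E n)).measurePreserving_homeomorphUnitSphereProd.integral_comp
    (Homeomorph.measurableEmbedding _) (fun z : Sph n × Ioi (0 : ℝ) => h z.1 * g z.2)
  rw [finrank_E_sub_one] at h2
  rw [← h2]
  refine integral_congr_ae (Eventually.of_forall fun x => ?_)
  simp only
  rw [← hf _ _ (homeomorphUnitSphereProd (E n) x).2.2]
  simp only [homeomorphUnitSphereProd_apply_fst_coe, homeomorphUnitSphereProd_apply_snd_coe]
  rw [smul_smul, mul_inv_cancel₀ (norm_ne_zero_iff.mpr x.2), one_smul]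

/-- By Fubini almost every radial slice is integrable in θ; the radii below 1 have positive measure,
so one of these slices has a nonzero factor `g r`, which can be divided out. -/
theorem integrable_toSphere_of_integrable {n : ℕ} {f : E n → ℝ} {g : ℝ → ℝ} {h : Sph n → ℝ}
    (hf : ∀ (θ : Sph n) (r : ℝ), 0 < r → f (r • (θ : E n)) = h θ * g r)
    (hg : ∀ r ∈ Ioo (0 : ℝ) 1, g r ≠ 0) (hint : Integrable f) :
    Integrable h (volume : Measure (E n)).toSphere := by
  have h2 := (volume : Measure (E n)).measurePreserving_homeomorphUnitSphereProd.integrable_comp_emb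
    (Homeomorph.measurableEmbedding _) (g := fun z : Sph n × Ioi (0 : ℝ) => h z.1 * g z.2)
  rw [finrank_E_sub_one] at h2
  have h3 : Integrable (fun z : Sph n × Ioi (0 : ℝ) => h z.1 * g z.2)
      ((volume : Measure (E n)).toSphere.prod (Measure.volumeIoiPow n)) := by
    rw [← h2]
    have h4 : Integrable (fun x : ({(0 : E n)}ᶜ : Set (E n)) => f x)
        ((volume : Measure (E n)).comap (↑)) := by
      have := (integrableOn_iff_comap_subtypeVal (μ := (volume : Measure (E n)))
        (f := f) (measurableSet_singleton (0 : E n)).compl).mp hint.integrableOn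
      exact this
    refine h4.congr (Eventually.of_forall fun x => ?_)
    simp only [Function.comp]
    rw [← hf _ _ (homeomorphUnitSphereProd (E n) x).2.2]
    simp only [homeomorphUnitSphereProd_apply_fst_coe, homeomorphUnitSphereProd_apply_snd_coe]
    rw [smul_smul, mul_inv_cancel₀ (norm_ne_zero_iff.mpr x.2), one_smul]
  have h5 := h3.prod_left_ae
  have h6 : ∃ r ∈ Iio (⟨1, mem_Ioi.2 one_pos⟩ : Ioi (0 : ℝ)),
      Integrable (fun θ => h θ * g r) (volume : Measure (E n)).toSphere := by
    by_contra hcon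
    push Not at hcon
    have h7 : Measure.volumeIoiPow n (Iio ⟨1, mem_Ioi.2 one_pos⟩) = 0 :=
      measure_mono_null (fun r hr => hcon r hr) h5
    rw [Measure.volumeIoiPow_apply_Iio] at h7
    simp at h7
    linarith
  obtain ⟨r, hr, hi⟩ := h6
  have hr' : g r ≠ 0 := hg r ⟨r.2, hr⟩
  refine (hi.mul_const (g r)⁻¹).congr (Eventually.of_forall fun θ => ?_)
  simp only
  field_simp

theorem lastCoord_smul {n : ℕ} (r : ℝ) (x : E n) : lastCoord (r • x) = r * lastCoord x := by
  simp [lastCoord]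

theorem contDiff_lastCoord {n : ℕ} {k : WithTop ℕ∞} :
    ContDiff ℝ k (lastCoord : E n → ℝ) := by
  unfold lastCoord; fun_prop

@[fun_prop]
theorem continuous_lastCoord {n : ℕ} : Continuous (lastCoord : E n → ℝ) :=
  (contDiff_lastCoord (k := 0)).continuous

@[fun_prop]
theorem measurable_lastCoord {n : ℕ} : Measurable (lastCoord : E n → ℝ) :=
  continuous_lastCoord.measurable

theorem isOpen_upperHalf (n : ℕ) : IsOpen (upperHalf n) :=
  isOpen_lt continuous_const continuous_lastCoord

theorem isOpen_hemisphere (n : ℕ) : IsOpen (hemisphere n) :=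
  isOpen_lt continuous_const (continuous_lastCoord.comp continuous_subtype_val)

theorem abs_coord_le_norm {n : ℕ} (x : E n) (i : Fin (n + 1)) : |x i| ≤ ‖x‖ :=
  PiLp.norm_apply_le x i

/-- A power `θ_N^a` with `a > -1` is integrable on the hemisphere. -/
theorem integrable_lastCoord_rpow {n : ℕ} {a : ℝ} (ha : -1 < a) :
    Integrable (fun θ : Sph n => lastCoord (θ : E n) ^ a) (hemiMeasure n) := by
  -- On the upper half of the unit ball, x_N^a agrees with a product of integrable one-variable
  -- functions. Homogeneity of x_N^a then carries integrability from the half ball to the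
  -- hemisphere.
  have hbox : Integrable (fun x : Fin (n + 1) → ℝ => ∏ i,
      (if i = Fin.last n then (Ioc (0 : ℝ) 1).indicator (fun t => t ^ a)
        else (Icc (-1 : ℝ) 1).indicator (fun _ => 1)) (x i)) := by
    refine Integrable.fintype_prod (𝕜 := ℝ) (f := fun i => (if i = Fin.last n then
      (Ioc (0 : ℝ) 1).indicator (fun t => t ^ a)
        else (Icc (-1 : ℝ) 1).indicator (fun _ => (1 : ℝ)))) (fun i => ?_)
    split_ifs
    · rw [integrable_indicator_iff measurableSet_Ioc]
      exact (intervalIntegrable_iff_integrableOn_Ioc_of_le zero_le_one).mp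
        (intervalIntegral.intervalIntegrable_rpow' ha)
    · rw [integrable_indicator_iff measurableSet_Icc]
      exact continuous_const.integrableOn_Icc
  have hbox' : Integrable (fun x : E n => ∏ i,
      (if i = Fin.last n then (Ioc (0 : ℝ) 1).indicator (fun t => t ^ a)
        else (Icc (-1 : ℝ) 1).indicator (fun _ => 1)) (x i)) :=
    ((EuclideanSpace.volume_preserving_symm_measurableEquiv_toLp
      (Fin (n + 1))).integrable_comp_emb (MeasurableEquiv.measurableEmbedding _)).mpr hbox
  set S : Set (E n) := upperHalf n ∩ ball 0 1 with hS
  have hSm : MeasurableSet S := (isOpen_upperHalf n).measurableSet.inter measurableSet_ball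
  have hint : Integrable (S.indicator fun x : E n => lastCoord x ^ a) := by
    rw [integrable_indicator_iff hSm]
    refine (hbox'.integrableOn (s := S)).congr_fun (fun x hx => ?_) hSm
    have h1 : ∀ i, |x i| ≤ 1 := fun i => (abs_coord_le_norm x i).trans
      (by simpa using (mem_ball_zero_iff.mp hx.2).le)
    simp only
    rw [Fin.prod_univ_castSucc]
    have h0 : 0 < x (Fin.last n) := hx.1
    have h2 : ∀ i : Fin n, i.castSucc ≠ Fin.last n := fun i => (Fin.castSucc_lt_last i).ne
    rw [Finset.prod_eq_one]
    · simp [h0, (abs_le.mp (h1 (Fin.last n))).2, lastCoord]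
    · intro i _
      simp [h2, (abs_le.mp (h1 i.castSucc)).1, (abs_le.mp (h1 i.castSucc)).2]
  have := integrable_toSphere_of_integrable (f := S.indicator fun x : E n => lastCoord x ^ a)
    (g := (Iio (1 : ℝ)).indicator fun r => r ^ a)
    (h := (hemisphere n).indicator fun θ : Sph n => lastCoord (θ : E n) ^ a) ?_ ?_ hint
  · rwa [integrable_indicator_iff (isOpen_hemisphere n).measurableSet] at this
  · intro θ r hr
    have hθ : ‖(θ : E n)‖ = 1 := by simp
    have hmem : r • (θ : E n) ∈ S ↔ θ ∈ hemisphere n ∧ r < 1 := by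
      simp only [hS, upperHalf, hemisphere, mem_inter_iff, mem_ofPred_eq, mem_ball_zero_iff,
        lastCoord_smul, norm_smul, hθ, mul_one, Real.norm_of_nonneg hr.le]
      rw [mul_pos_iff_of_pos_left hr]
    by_cases h1 : θ ∈ hemisphere n
    · by_cases h2 : r < 1
      · rw [indicator_of_mem (hmem.mpr ⟨h1, h2⟩), indicator_of_mem h1,
          indicator_of_mem (mem_Iio.mpr h2), lastCoord_smul, Real.mul_rpow hr.le (le_of_lt h1),
          mul_comm]
      · rw [indicator_of_notMem (fun h => h2 (hmem.mp h).2),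
          indicator_of_notMem (s := Iio (1 : ℝ)) h2, mul_zero]
    · rw [indicator_of_notMem (fun h => h1 (hmem.mp h).1), indicator_of_notMem h1, zero_mul]
  · intro r hr
    rw [indicator_of_mem (mem_Iio.mpr hr.2)]
    exact (Real.rpow_pos_of_pos hr.1 _).ne'

/-! ### The divergence theorem on the sphere -/

theorem integral_euclDiv_eq_zero {n : ℕ} {X : E n → E n} (hX : ContDiff ℝ ∞ X)
    (hc : HasCompactSupport X) : ∫ x, euclDiv X x = 0 := by
  have hcont : Continuous (fderiv ℝ X) := hX.continuous_fderiv (by simp)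
  have hcomp : ∀ i : Fin (n + 1), ∀ x,
      fderiv ℝ (fun y => X y i) x (EuclideanSpace.single i 1)
        = (fderiv ℝ X x (EuclideanSpace.single i 1)) i := by
    intro i x
    have h := ((EuclideanSpace.proj (𝕜 := ℝ) i).hasFDerivAt (x := X x)).comp x
      (hX.differentiable (by simp) x).hasFDerivAt
    have h' : HasFDerivAt (fun y => X y i) _ x := h
    rw [h'.fderiv]; rfl
  have hint : ∀ i : Fin (n + 1),
      Integrable (fun x => (fderiv ℝ X x (EuclideanSpace.single i 1)) i) := by
    intro i
    refine Continuous.integrable_of_hasCompactSupport (by fun_prop) ?_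
    exact (hc.fderiv ℝ).comp_left (g := fun L : E n →L[ℝ] E n => (L (EuclideanSpace.single i 1)) i)
      (by simp)
  unfold euclDiv
  rw [integral_finsetSum _ fun i _ => hint i]
  refine Finset.sum_eq_zero fun i _ => ?_
  have hi : Integrable (fun x => X x i) :=
    Continuous.integrable_of_hasCompactSupport (by have := hX.continuous; fun_prop)
      (hc.comp_left (g := fun v : E n => v i) (by simp))
  have := integral_mul_fderiv_eq_neg_fderiv_mul_of_integrable (μ := (volume : Measure (E n)))
    (f := fun _ => (1 : ℝ)) (g := fun x => X x i) (v := EuclideanSpace.single i 1)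
    (by simp) (by simpa [hcomp] using hint i) (by simpa using hi) (by simp)
    (fun x _ => by
      have := hX.differentiable (by simp) x
      fun_prop)
  simpa [hcomp] using this

/-- The extension of a field on the sphere, constant along rays and cut off away from the sphere. -/
noncomputable def radialExtension {n : ℕ} (ψ : ℝ → ℝ) (X : E n → E n) (x : E n) : E n :=
  ψ (‖x‖ ^ 2) • X (‖x‖⁻¹ • x)

theorem contDiff_radialExtension {n : ℕ} {ψ : ℝ → ℝ} {X : E n → E n} (hX : ContDiff ℝ ∞ X)
    (hψ : ContDiff ℝ ∞ ψ) (h0 : ψ =ᶠ[𝓝 0] 0) : ContDiff ℝ ∞ (radialExtension ψ X) := by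
  rw [contDiff_iff_contDiffAt]
  intro x
  by_cases hx : x = 0
  · subst hx
    have h1 : Tendsto (fun y : E n => ‖y‖ ^ 2) (𝓝 0) (𝓝 0) := by
      have : Continuous fun y : E n => ‖y‖ ^ 2 := by fun_prop
      simpa using this.tendsto 0
    have h2 : radialExtension ψ X =ᶠ[𝓝 0] fun _ => 0 := by
      filter_upwards [h1.eventually h0] with y hy
      simp [radialExtension, hy]
    exact contDiffAt_const.congr_of_eventuallyEq h2
  · have hn : ContDiffAt ℝ ∞ (fun y : E n => ‖y‖) x := contDiffAt_norm ℝ hx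
    have h1 : ContDiffAt ℝ ∞ (fun y : E n => ‖y‖⁻¹ • y) x :=
      (hn.inv (norm_ne_zero_iff.mpr hx)).smul contDiffAt_id
    exact (hψ.contDiffAt.comp x (hn.pow 2)).smul (hX.contDiffAt.comp x h1)

theorem hasCompactSupport_radialExtension {n : ℕ} {ψ : ℝ → ℝ} {X : E n → E n}
    (hψ : ∀ t, 2 ≤ t → ψ t = 0) : HasCompactSupport (radialExtension ψ X) := by
  refine HasCompactSupport.intro (isCompact_closedBall (0 : E n) 2) fun x hx => ?_
  have : 2 < ‖x‖ := by simpa using hx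
  rw [radialExtension, hψ _ (by nlinarith), zero_smul]

theorem hasFDerivAt_normalize {n : ℕ} (θ : Sph n) {r : ℝ} (hr : 0 < r) :
    HasFDerivAt (fun y : E n => ‖y‖⁻¹ • y)
      (r⁻¹ • (ContinuousLinearMap.id ℝ (E n) - (innerSL ℝ (θ : E n)).smulRight (θ : E n)))
      (r • (θ : E n)) := by
  have hθ : ‖(θ : E n)‖ = 1 := by simp
  have hnr : ‖r • (θ : E n)‖ = r := by rw [norm_smul, hθ, mul_one, Real.norm_of_nonneg hr.le]
  have hx : r • (θ : E n) ≠ 0 := by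
    rw [← norm_ne_zero_iff, hnr]; exact hr.ne'
  have hsq : HasFDerivAt (fun y : E n => ‖y‖ ^ 2) (2 • (innerSL ℝ (r • (θ : E n))))
      (r • (θ : E n)) := (hasStrictFDerivAt_norm_sq _).hasFDerivAt
  have hs := hsq.sqrt (by rw [hnr]; positivity)
  have hs2 : HasFDerivAt (fun y : E n => ‖y‖) (innerSL ℝ (θ : E n)) (r • (θ : E n)) := by
    have : (fun y : E n => √(‖y‖ ^ 2)) = fun y => ‖y‖ := by
      ext y; rw [Real.sqrt_sq (norm_nonneg _)]
    rw [this] at hs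
    refine hs.congr_fderiv (ContinuousLinearMap.ext fun v => ?_)
    simp only [hnr, Real.sqrt_sq hr.le, smul_apply, innerSL_apply_apply,
      smul_eq_mul, nsmul_eq_mul, map_smul]
    simp
    field_simp
  have hinv := (hasDerivAt_inv (by rw [hnr]; exact hr.ne' : ‖r • (θ : E n)‖ ≠ 0)).comp_hasFDerivAt
    (r • (θ : E n)) hs2
  have := hinv.smul (hasFDerivAt_id (r • (θ : E n)))
  have h3 : HasFDerivAt (fun y : E n => ‖y‖⁻¹ • y) _ (r • (θ : E n)) := this
  refine h3.congr_fderiv (ContinuousLinearMap.ext fun v => ?_)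
  simp only [hnr, smul_apply, add_apply,
    sub_apply, ContinuousLinearMap.smulRight_apply, innerSL_apply_apply,
    ContinuousLinearMap.id_apply, smul_smul, smul_eq_mul, smul_sub, id, Function.comp]
  have : -(r ^ 2)⁻¹ * inner ℝ (θ : E n) v * r = -(r⁻¹ * inner ℝ (θ : E n) v) := by field_simp
  rw [this, neg_smul, sub_eq_add_neg]

theorem map_eq_sum_single {n : ℕ} {F : Type*} [AddCommGroup F] [Module ℝ F]
    [TopologicalSpace F] (L : E n →L[ℝ] F) (v : E n) :
    L v = ∑ i, v i • L (EuclideanSpace.single i 1) := by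
  have : v = ∑ i, v i • EuclideanSpace.single i (1 : ℝ) := by
    simpa using ((EuclideanSpace.basisFun (Fin (n + 1)) ℝ).sum_repr v).symm
  conv_lhs => rw [this, map_sum]
  simp only [map_smul]

theorem euclDiv_smul {n : ℕ} {f : E n → ℝ} {X : E n → E n} {x : E n}
    (hf : DifferentiableAt ℝ f x) (hX : DifferentiableAt ℝ X x) :
    euclDiv (fun y => f y • X y) x = f x * euclDiv X x + fderiv ℝ f x (X x) := by
  have h : HasFDerivAt (fun y => f y • X y) _ x := hf.hasFDerivAt.smul hX.hasFDerivAt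
  rw [euclDiv, h.fderiv, map_eq_sum_single (fderiv ℝ f x) (X x), euclDiv, Finset.mul_sum,
    ← Finset.sum_add_distrib]
  simp [mul_comm]

theorem sphereDiv_smul {n : ℕ} {f : E n → ℝ} {X : E n → E n} {x : E n}
    (hf : DifferentiableAt ℝ f x) (hX : DifferentiableAt ℝ X x) (ht : inner ℝ (X x) x = 0) :
    sphereDiv (fun y => f y • X y) x = f x * sphereDiv X x + fderiv ℝ f x (X x) := by
  have h : HasFDerivAt (fun y => f y • X y) _ x := hf.hasFDerivAt.smul hX.hasFDerivAt
  rw [sphereDiv, euclDiv_smul hf hX, h.fderiv, sphereDiv]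
  simp [inner_add_left, inner_smul_left, ht]
  ring

/-- The gradient of ψ(|x|²) is radial, hence orthogonal to the tangential field, and drops out. The
derivative of x/|x| is r⁻¹ times the tangential projection, so what remains is r⁻¹ times the trace
of DX over the tangent space. -/
theorem euclDiv_radialExtension {n : ℕ} {ψ : ℝ → ℝ} {X : E n → E n} (hX : ContDiff ℝ ∞ X)
    (hψ : ContDiff ℝ ∞ ψ) {θ : Sph n} (ht : inner ℝ (X θ) (θ : E n) = 0) {r : ℝ} (hr : 0 < r) :
    euclDiv (radialExtension ψ X) (r • (θ : E n)) = sphereDiv X θ * (ψ (r ^ 2) * r⁻¹) := by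
  have hθ : ‖(θ : E n)‖ = 1 := by simp
  have hnr : ‖r • (θ : E n)‖ = r := by rw [norm_smul, hθ, mul_one, Real.norm_of_nonneg hr.le]
  have hpt : ‖r • (θ : E n)‖⁻¹ • (r • (θ : E n)) = θ := by
    rw [hnr, smul_smul, inv_mul_cancel₀ hr.ne', one_smul]
  have hsq : HasFDerivAt (fun y : E n => ‖y‖ ^ 2) (2 • (innerSL ℝ (r • (θ : E n))))
      (r • (θ : E n)) := (hasStrictFDerivAt_norm_sq _).hasFDerivAt
  have h1 : HasFDerivAt (fun y : E n => ψ (‖y‖ ^ 2)) _ (r • (θ : E n)) :=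
    ((hψ.differentiable (by simp) (‖r • (θ : E n)‖ ^ 2)).hasDerivAt).comp_hasFDerivAt
    (r • (θ : E n)) hsq
  have h2 : HasFDerivAt (fun y : E n => X (‖y‖⁻¹ • y)) _ (r • (θ : E n)) :=
    HasFDerivAt.comp (r • (θ : E n)) (g := X) (f := fun y : E n => ‖y‖⁻¹ • y)
    (hX.differentiable (by simp) _).hasFDerivAt (hasFDerivAt_normalize θ hr)
  rw [hpt] at h2
  have h3 : euclDiv (fun y : E n => X (‖y‖⁻¹ • y)) (r • (θ : E n)) = r⁻¹ * sphereDiv X θ := by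
    have h5 : ∑ i, (θ : E n) i * (fderiv ℝ X θ (θ : E n)) i
        = inner ℝ (fderiv ℝ X θ (θ : E n)) (θ : E n) := by
      simp [PiLp.inner_apply]
    rw [euclDiv, h2.fderiv, sphereDiv, euclDiv, mul_sub, Finset.mul_sum, ← h5, Finset.mul_sum,
      ← Finset.sum_sub_distrib]
    refine Finset.sum_congr rfl fun i _ => ?_
    simp [EuclideanSpace.inner_single_right, map_smul]
    ring
  have h4 : euclDiv (radialExtension ψ X) (r • (θ : E n)) = _ :=
    euclDiv_smul h1.differentiableAt h2.differentiableAt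
  rw [h4, h3, h1.fderiv, hpt, hnr]
  have ht' : inner ℝ (θ : E n) (X θ) = 0 := by rw [real_inner_comm]; exact ht
  simp [ht']
  ring

/-- The divergence theorem on the sphere, for fields supported in the upper hemisphere. -/
theorem IsTestField.integral_sphereDiv_eq_zero {n : ℕ} {X : E n → E n} (hX : IsTestField X) :
    ∫ θ : Sph n, sphereDiv X θ ∂(hemiMeasure n) = 0 := by
  have hsupp : ∀ x : E n, x ∉ upperHalf n → sphereDiv X x = 0 := by
    intro x hx
    have : fderiv ℝ X x = 0 := by
      by_contra h
      exact hx (hX.support (support_fderiv_subset ℝ h))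
    simp [sphereDiv, euclDiv, this]
  rw [hemiMeasure, setIntegral_eq_integral_of_forall_compl_eq_zero
    (s := hemisphere n) (f := fun θ : Sph n => sphereDiv X θ) (fun θ hθ => hsupp _ hθ)]
  let b : ContDiffBump (1 : ℝ) := ⟨1 / 4, 1 / 2, by norm_num, by norm_num⟩
  have hb0 : ∀ t : ℝ, t ≤ 1 / 2 → b t = 0 := fun t ht => b.zero_of_le_dist <| by
    rw [Real.dist_eq, abs_sub_comm]
    exact le_trans (show (1 / 2 : ℝ) ≤ 1 - t by linarith) (le_abs_self _)
  have hb2 : ∀ t : ℝ, 2 ≤ t → b t = 0 := fun t ht => b.zero_of_le_dist <| by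
    rw [Real.dist_eq]
    exact le_trans (show (1 / 2 : ℝ) ≤ t - 1 by linarith) (le_abs_self _)
  have hb : (b : ℝ → ℝ) =ᶠ[𝓝 0] 0 := by
    filter_upwards [Iio_mem_nhds (show (0 : ℝ) < 1 / 2 by norm_num)] with t ht
    exact hb0 t (le_of_lt ht)
  -- The extra factor t turns the radial factor into b(r²) r, the profile of the continuous function
  -- b(|x|²)|x| on the whole space. Its integral is positive, so the radial factor cannot vanish and
  -- the spherical one must.
  have hbs : ContDiff ℝ ∞ (fun t => b t * t) := b.contDiff.mul contDiff_id
  have h1 := integral_eq_toSphere_mul (f := euclDiv (radialExtension (fun t => b t * t) X))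
    (g := fun r => b (r ^ 2) * r ^ 2 * r⁻¹) (h := fun θ => sphereDiv X θ)
    fun θ r hr => euclDiv_radialExtension hX.smooth hbs (hX.tangent θ) hr
  rw [integral_euclDiv_eq_zero (contDiff_radialExtension hX.smooth hbs
    (hb.mono fun t ht => by simp [ht]))
    (hasCompactSupport_radialExtension fun t ht => by simp [hb2 t ht])] at h1
  refine (mul_eq_zero.mp h1.symm).resolve_right fun h2 => ?_
  have h3 := integral_eq_toSphere_mul (f := fun x : E n => b (‖x‖ ^ 2) * ‖x‖)
    (g := fun r => b (r ^ 2) * r ^ 2 * r⁻¹) (h := fun _ => 1) fun θ r hr => by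
      simp only [norm_smul, Real.norm_of_nonneg hr.le, norm_eq_of_mem_sphere, mul_one, one_mul]
      field_simp
  rw [h2, mul_zero] at h3
  have hc : Continuous fun x : E n => b (‖x‖ ^ 2) * ‖x‖ := by
    have := b.continuous
    fun_prop
  refine (hc.integral_pos_of_hasCompactSupport_nonneg_nonzero (μ := volume) ?_
    (fun x => mul_nonneg b.nonneg (norm_nonneg _)) (x := EuclideanSpace.single 0 1) ?_).ne' h3
  · refine HasCompactSupport.intro (isCompact_closedBall (0 : E n) 2) fun x hx => ?_
    have : 2 < ‖x‖ := by simpa using hx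
    rw [hb2 _ (by nlinarith), zero_mul]
  · have : b 1 = 1 := b.one_of_mem_closedBall (by simp [b])
    simp [this]

/-! ### Polynomial algebra -/

open MvPolynomial in
/-- The Laplacian on polynomials. -/
noncomputable def polyLaplacian (σ : Type*) [Fintype σ] :
    MvPolynomial σ ℝ →ₗ[ℝ] MvPolynomial σ ℝ :=
  ∑ i : σ, (pderiv i).toLinearMap ∘ₗ (pderiv i).toLinearMap

/-- The polynomial `|x|²`. -/
noncomputable def polyNormSq (σ : Type*) [Fintype σ] : MvPolynomial σ ℝ :=
  ∑ i : σ, MvPolynomial.X i ^ 2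

section Polynomial

open MvPolynomial

variable {σ : Type*} [Fintype σ]

theorem polyLaplacian_apply (p : MvPolynomial σ ℝ) :
    polyLaplacian σ p = ∑ i, pderiv i (pderiv i p) := by
  simp [polyLaplacian]

theorem polyNormSq_isHomogeneous : (polyNormSq σ).IsHomogeneous 2 :=
  IsHomogeneous.sum _ _ _ fun i _ => by simpa using (isHomogeneous_X ℝ i).pow 2

theorem pderiv_polyNormSq [DecidableEq σ] (i : σ) :
    pderiv i (polyNormSq σ) = 2 * X i := by
  simp [polyNormSq, pderiv_X, Pi.single_apply, Derivation.leibniz_pow]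

theorem polyLaplacian_isHomogeneous {p : MvPolynomial σ ℝ} {k : ℕ} (hp : p.IsHomogeneous k) :
    (polyLaplacian σ p).IsHomogeneous (k - 2) := by
  rw [polyLaplacian_apply]
  exact IsHomogeneous.sum _ _ _ fun i _ => hp.pderiv.pderiv

theorem polyLaplacian_eq_zero {p : MvPolynomial σ ℝ} {k : ℕ} (hp : p.IsHomogeneous k)
    (hk : k < 2) : polyLaplacian σ p = 0 := by
  rw [polyLaplacian_apply]
  refine Finset.sum_eq_zero fun i _ => ?_
  have h : (pderiv i p).IsHomogeneous 0 := by
    have := hp.pderiv (i := i)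
    rwa [show k - 1 = 0 by omega] at this
  rw [totalDegree_eq_zero_iff_eq_C.mp (Nat.le_zero.mp h.totalDegree_le), pderiv_C]

theorem polyLaplacian_pow_isHomogeneous {p : MvPolynomial σ ℝ} {k : ℕ} (hp : p.IsHomogeneous k)
    (j : ℕ) : ((polyLaplacian σ ^ j) p).IsHomogeneous (k - 2 * j) := by
  induction j with
  | zero => simpa using hp
  | succ j ih =>
    rw [pow_succ', Module.End.mul_apply]
    have := polyLaplacian_isHomogeneous ih
    rwa [show k - 2 * j - 2 = k - 2 * (j + 1) by omega] at this

theorem polyLaplacian_pow_eq_zero {p : MvPolynomial σ ℝ} {k : ℕ} (hp : p.IsHomogeneous k)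
    {j : ℕ} (hj : k < 2 * j) : (polyLaplacian σ ^ j) p = 0 := by
  induction j with
  | zero => omega
  | succ j ih =>
    rw [pow_succ', Module.End.mul_apply]
    by_cases h : k < 2 * j
    · rw [ih h, map_zero]
    · exact polyLaplacian_eq_zero (polyLaplacian_pow_isHomogeneous hp j) (by omega)

theorem pderiv_polyNormSq_pow [DecidableEq σ] (i : σ) (j : ℕ) :
    pderiv i (polyNormSq σ ^ (j + 1)) = C (2 * (j + 1 : ℝ)) * (polyNormSq σ ^ j * X i) := by
  rw [Derivation.leibniz_pow, pderiv_polyNormSq]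
  simp only [Nat.add_sub_cancel, smul_eq_mul, nsmul_eq_mul, map_mul, map_add, map_natCast, map_one,
    Nat.cast_add, Nat.cast_one, map_ofNat]
  ring

theorem sum_X_mul_pderiv_eq {h : MvPolynomial σ ℝ} {k : ℕ} (hh : h.IsHomogeneous k) :
    ∑ i, X i * pderiv i h = C (k : ℝ) * h := by
  rw [hh.sum_X_mul_pderiv, nsmul_eq_mul]; simp

/-- Leibniz rule, with Euler's identity applied to h in the cross terms and to |x|^{2j} in the
second derivatives of |x|^{2j+2}. -/
theorem polyLaplacian_polyNormSq_pow_mul [DecidableEq σ] {h : MvPolynomial σ ℝ} {k : ℕ}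
    (hh : h.IsHomogeneous k) (j : ℕ) :
    polyLaplacian σ (polyNormSq σ ^ (j + 1) * h) = polyNormSq σ ^ (j + 1) * polyLaplacian σ h
      + C (2 * (j + 1 : ℝ) * (2 * k + 2 * j + Fintype.card σ)) * (polyNormSq σ ^ j * h) := by
  have h1 : ∀ i : σ, pderiv i (pderiv i (polyNormSq σ ^ (j + 1) * h))
      = polyNormSq σ ^ (j + 1) * pderiv i (pderiv i h)
        + C (2 * (2 * (j + 1 : ℝ))) * polyNormSq σ ^ j * (X i * pderiv i h)
        + C (2 * (j + 1 : ℝ)) * (polyNormSq σ ^ j * h)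
        + C (2 * (j + 1 : ℝ)) * h * (X i * pderiv i (polyNormSq σ ^ j)) := by
    intro i
    simp only [map_add, pderiv_mul, pderiv_polyNormSq_pow, pderiv_C, pderiv_X_self]
    simp only [map_mul, map_ofNat]
    ring
  have h2 : ∑ i, X i * pderiv i (polyNormSq σ ^ j) = C (2 * j : ℝ) * polyNormSq σ ^ j := by
    rw [sum_X_mul_pderiv_eq ((polyNormSq_isHomogeneous (σ := σ)).pow j)]
    push_cast; rfl
  simp only [polyLaplacian_apply, h1, Finset.sum_add_distrib, ← Finset.mul_sum, h2,
    sum_X_mul_pderiv_eq hh, Finset.sum_const, Finset.card_univ, nsmul_eq_mul]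
  simp only [map_mul, map_ofNat, map_add, map_natCast, map_one]
  ring

theorem pderiv_last_rename {n : ℕ} (p : MvPolynomial (Fin n) ℝ) :
    pderiv (Fin.last n) (rename Fin.castSucc p) = 0 := by
  induction p using MvPolynomial.induction_on with
  | C a => simp
  | add p q hp hq => rw [map_add, map_add, hp, hq, add_zero]
  | mul_X p i hp =>
    rw [map_mul, pderiv_mul, hp, rename_X, pderiv_X_of_ne (Fin.castSucc_lt_last i).ne]
    simp

theorem pderiv_castSucc_rename {n : ℕ} (i : Fin n) (p : MvPolynomial (Fin n) ℝ) :
    pderiv i.castSucc (rename Fin.castSucc p) = rename Fin.castSucc (pderiv i p) := by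
  induction p using MvPolynomial.induction_on with
  | C a => simp
  | add p q hp hq => simp only [map_add, hp, hq]
  | mul_X p j hp =>
    simp only [map_mul, pderiv_mul, hp, rename_X, map_add]
    by_cases h : j = i
    · subst h; simp
    · rw [pderiv_X_of_ne h, pderiv_X_of_ne (fun h' => h (Fin.castSucc_injective n h'))]
      simp

theorem polyLaplacian_rename {n : ℕ} (p : MvPolynomial (Fin n) ℝ) :
    polyLaplacian (Fin (n + 1)) (rename Fin.castSucc p)
      = rename Fin.castSucc (polyLaplacian (Fin n) p) := by
  rw [polyLaplacian_apply, polyLaplacian_apply, Fin.sum_univ_castSucc, map_sum]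
  simp only [pderiv_castSucc_rename, pderiv_last_rename, map_zero, add_zero]

/-- The coefficients of the `|x|^{2j} Δ^j p` in the extension of `p`. -/
noncomputable def extCoeff (n : ℕ) (γ : ℝ) (ℓ : ℕ) : ℕ → ℝ
  | 0 => 1
  -- The denominator is the factor that x_N Δ + (1+2γ) ∂_N puts on x_N |x|^{2j} Δ^{j+1} p when
  -- applied to |x|^{2(j+1)} Δ^{j+1} p. For γ > 0 it is positive when 2(j+1) ≤ ℓ; for larger j the
  -- polynomial Δ^{j+1} p is zero and the coefficient is irrelevant.
  | j + 1 => - extCoeff n γ ℓ j / (2 * (j + 1) * (2 * ℓ - 2 * j - 2 + n + 2 * γ))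

/-- The polynomial `∑_j d_j |x|^{2j} Δ^j p(x̄)`. -/
noncomputable def extPoly {n : ℕ} (γ : ℝ) (ℓ : ℕ) :
    MvPolynomial (Fin n) ℝ →ₗ[ℝ] MvPolynomial (Fin (n + 1)) ℝ :=
  ∑ j ∈ Finset.range (ℓ + 1), extCoeff n γ ℓ j •
    (LinearMap.mulLeft ℝ (polyNormSq (Fin (n + 1)) ^ j) ∘ₗ
      (rename (R := ℝ) Fin.castSucc).toLinearMap ∘ₗ (polyLaplacian (Fin n) ^ j))

theorem extPoly_apply {n : ℕ} (γ : ℝ) (ℓ : ℕ) (p : MvPolynomial (Fin n) ℝ) :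
    extPoly γ ℓ p = ∑ j ∈ Finset.range (ℓ + 1), C (extCoeff n γ ℓ j) *
      (polyNormSq (Fin (n + 1)) ^ j * rename Fin.castSucc ((polyLaplacian (Fin n) ^ j) p)) := by
  simp [extPoly, LinearMap.sum_apply, smul_eq_C_mul]

theorem extPoly_isHomogeneous {n : ℕ} (γ : ℝ) {ℓ : ℕ} {p : MvPolynomial (Fin n) ℝ}
    (hp : p.IsHomogeneous ℓ) : (extPoly γ ℓ p).IsHomogeneous ℓ := by
  rw [extPoly_apply]
  refine IsHomogeneous.sum _ _ _ fun j _ => ?_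
  by_cases hj : ℓ < 2 * j
  · rw [polyLaplacian_pow_eq_zero hp hj]
    simpa using isHomogeneous_zero _ _ _
  · have h := (isHomogeneous_C (Fin (n + 1)) (extCoeff n γ ℓ j)).mul
      (((polyNormSq_isHomogeneous (σ := Fin (n + 1))).pow j).mul
        ((polyLaplacian_pow_isHomogeneous hp j).rename_isHomogeneous (f := Fin.castSucc)))
    rwa [show 0 + (2 * j + (ℓ - 2 * j)) = ℓ by omega] at h

/-- The extension polynomial solves the weighted Laplace equation. -/
theorem extPoly_equation {n : ℕ} {γ : ℝ} (hγ : 0 < γ) {ℓ : ℕ} {p : MvPolynomial (Fin n) ℝ}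
    (hp : p.IsHomogeneous ℓ) :
    X (Fin.last n) * polyLaplacian (Fin (n + 1)) (extPoly γ ℓ p)
      + C (1 + 2 * γ) * pderiv (Fin.last n) (extPoly γ ℓ p) = 0 := by
  set R := polyNormSq (Fin (n + 1))
  let D : ℕ → MvPolynomial (Fin (n + 1)) ℝ := fun j =>
    rename Fin.castSucc ((polyLaplacian (Fin n) ^ j) p)
  let c : ℕ → ℝ := fun j => 2 * (j + 1 : ℝ) * (2 * ℓ - 2 * j - 2 + n + 2 * γ)
  have hD : ∀ j, polyLaplacian (Fin (n + 1)) (D j) = D (j + 1) := fun j => by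
    simp only [D]
    rw [polyLaplacian_rename, pow_succ', Module.End.mul_apply]
  have hD0 : ∀ j, ℓ < 2 * j → D j = 0 := fun j hj => by
    simp only [D]; rw [polyLaplacian_pow_eq_zero hp hj, map_zero]
  -- D (j + 1) does not involve x_N, so ∂_N acts only on the power of R and brings out a factor x_N,
  -- matching the factor in front of the Laplacian.
  have hterm : ∀ j, X (Fin.last n) * polyLaplacian (Fin (n + 1)) (R ^ (j + 1) * D (j + 1))
      + C (1 + 2 * γ) * pderiv (Fin.last n) (R ^ (j + 1) * D (j + 1))
      = X (Fin.last n) * (R ^ (j + 1) * D (j + 1 + 1) + C (c j) * (R ^ j * D (j + 1))) := by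
    intro j
    by_cases hj : ℓ < 2 * (j + 1)
    · rw [hD0 _ hj, hD0 (j + 1 + 1) (by omega)]; simp
    · have hh : (D (j + 1)).IsHomogeneous (ℓ - 2 * (j + 1)) :=
        (polyLaplacian_pow_isHomogeneous hp (j + 1)).rename_isHomogeneous
      rw [polyLaplacian_polyNormSq_pow_mul hh, hD, pderiv_mul, pderiv_polyNormSq_pow,
        show pderiv (Fin.last n) (D (j + 1)) = 0 from pderiv_last_rename _]
      have hcast : ((ℓ - 2 * (j + 1) : ℕ) : ℝ) = ℓ - 2 * (j + 1) := by
        rw [Nat.cast_sub (by omega)]; push_cast; ring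
      have hc : C (c j) = (C (2 * (j + 1 : ℝ) * (2 * ((ℓ - 2 * (j + 1) : ℕ) : ℝ) + 2 * j
          + Fintype.card (Fin (n + 1)))) : MvPolynomial (Fin (n + 1)) ℝ)
          + C (1 + 2 * γ) * C (2 * (j + 1 : ℝ)) := by
        rw [← C_mul, ← C_add, hcast]
        congr 1
        simp only [c, Fintype.card_fin]; push_cast; ring
      rw [hc]; ring
  have hrec : ∀ j, C (extCoeff n γ ℓ j) * D (j + 1)
      + C (extCoeff n γ ℓ (j + 1)) * (C (c j) * D (j + 1)) = 0 := by
    intro j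
    by_cases hj : ℓ < 2 * (j + 1)
    · rw [hD0 _ hj]; simp
    · have hcj : c j ≠ 0 := by
        have : (2 * (j + 1) : ℝ) ≤ ℓ := by exact_mod_cast not_lt.mp hj
        have : (0 : ℝ) ≤ n := Nat.cast_nonneg n
        have : (0 : ℝ) ≤ j := Nat.cast_nonneg j
        have : 0 < (2 * ℓ - 2 * j - 2 + n + 2 * γ : ℝ) := by linarith
        positivity
      have : extCoeff n γ ℓ (j + 1) * c j = - extCoeff n γ ℓ j := by
        rw [extCoeff]; exact div_mul_cancel₀ _ hcj
      rw [← mul_assoc, ← C_mul, this, ← add_mul, ← C_add]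
      simp
  have hsplit : X (Fin.last n) * polyLaplacian (Fin (n + 1)) (extPoly γ ℓ p)
      + C (1 + 2 * γ) * pderiv (Fin.last n) (extPoly γ ℓ p)
      = ∑ j ∈ Finset.range (ℓ + 1), C (extCoeff n γ ℓ j) *
        (X (Fin.last n) * polyLaplacian (Fin (n + 1)) (R ^ j * D j)
        + C (1 + 2 * γ) * pderiv (Fin.last n) (R ^ j * D j)) := by
    rw [extPoly_apply, map_sum, map_sum, Finset.mul_sum, Finset.mul_sum, ← Finset.sum_add_distrib]
    refine Finset.sum_congr rfl fun j _ => ?_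
    have hRD : polyNormSq (Fin (n + 1)) ^ j * rename Fin.castSucc ((polyLaplacian (Fin n) ^ j) p)
        = R ^ j * D j := rfl
    rw [hRD]
    rw [show polyLaplacian (Fin (n + 1)) (C (extCoeff n γ ℓ j) * (R ^ j * D j))
      = C (extCoeff n γ ℓ j) * polyLaplacian (Fin (n + 1)) (R ^ j * D j) by
        rw [C_mul', map_smul, C_mul'], pderiv_mul (f := C (extCoeff n γ ℓ j)), pderiv_C]
    ring
  rw [hsplit, Finset.sum_range_succ']
  simp only [hterm, pow_zero, one_mul, hD, show pderiv (Fin.last n) (D 0) = 0 from pderiv_last_rename _]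
  -- By `hrec` the sum telescopes. At m = ℓ the only surviving term contains Δ^{ℓ+1} p, which is
  -- zero.
  have : ∀ m, ∑ j ∈ Finset.range m, C (extCoeff n γ ℓ (j + 1)) *
      (X (Fin.last n) * (R ^ (j + 1) * D (j + 1 + 1) + C (c j) * (R ^ j * D (j + 1))))
      + C (extCoeff n γ ℓ 0) * (X (Fin.last n) * D (0 + 1) + C (1 + 2 * γ) * 0)
      = X (Fin.last n) * R ^ m * (C (extCoeff n γ ℓ m) * D (m + 1)) := by
    intro m
    induction m with
    | zero => simp; ring
    | succ m ih =>
      rw [Finset.sum_range_succ, add_right_comm, ih]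
      linear_combination (X (Fin.last n) * R ^ m) * hrec m
  rw [this, hD0 _ (by omega)]
  simp

/-- The values on the sphere of the extension of `p` are polynomial in `x̄`. -/
noncomputable def spherePoly {n : ℕ} (γ : ℝ) (ℓ : ℕ) (p : MvPolynomial (Fin n) ℝ) :
    MvPolynomial (Fin n) ℝ :=
  ∑ j ∈ Finset.range (ℓ + 1), C (extCoeff n γ ℓ j) * (polyLaplacian (Fin n) ^ j) p

theorem norm_sq_eq_init_add_last {n : ℕ} (x : E n) :
    ‖x‖ ^ 2 = ∑ i, initCoord x i ^ 2 + lastCoord x ^ 2 := by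
  rw [EuclideanSpace.norm_sq_eq, Fin.sum_univ_castSucc]
  simp [initCoord, lastCoord]

theorem eval_polyNormSq {n : ℕ} (x : E n) :
    eval (x : Fin (n + 1) → ℝ) (polyNormSq (Fin (n + 1))) = ‖x‖ ^ 2 := by
  simp [polyNormSq, EuclideanSpace.norm_sq_eq]

theorem eval_rename_castSucc {n : ℕ} (x : E n) (q : MvPolynomial (Fin n) ℝ) :
    eval (x : Fin (n + 1) → ℝ) (rename Fin.castSucc q) = eval (initCoord x) q := by
  rw [eval_rename]; rfl

theorem eval_extPoly {n : ℕ} (γ : ℝ) (ℓ : ℕ) (p : MvPolynomial (Fin n) ℝ) (x : E n) :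
    eval (x : Fin (n + 1) → ℝ) (extPoly γ ℓ p) = ∑ j ∈ Finset.range (ℓ + 1), extCoeff n γ ℓ j *
      ((‖x‖ ^ 2) ^ j * eval (initCoord x) ((polyLaplacian (Fin n) ^ j) p)) := by
  simp [extPoly_apply, eval_polyNormSq, eval_rename_castSucc]

theorem eval_extPoly_sphere {n : ℕ} (γ : ℝ) (ℓ : ℕ) (p : MvPolynomial (Fin n) ℝ) (θ : Sph n) :
    eval ((θ : E n) : Fin (n + 1) → ℝ) (extPoly γ ℓ p)
      = eval (initCoord (θ : E n)) (spherePoly γ ℓ p) := by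
  simp [eval_extPoly, spherePoly]

/-- The j = 0 term is p itself and every Laplacian lowers the degree by two. This triangularity
drives both the nonvanishing and the totality of the solutions. -/
theorem totalDegree_spherePoly_sub_lt {n : ℕ} (γ : ℝ) {ℓ : ℕ} (hℓ : 0 < ℓ)
    {p : MvPolynomial (Fin n) ℝ} (hp : p.IsHomogeneous ℓ) :
    (spherePoly γ ℓ p - p).totalDegree < ℓ := by
  rw [spherePoly, Finset.sum_range_succ']
  simp only [extCoeff, pow_zero, Module.End.one_apply, map_one, one_mul, add_sub_cancel_right]
  refine lt_of_le_of_lt (totalDegree_finsetSum_le (d := ℓ - 1) fun j _ => ?_) (by omega)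
  refine (totalDegree_mul _ _).trans ?_
  rw [totalDegree_C, zero_add]
  exact (polyLaplacian_pow_isHomogeneous hp (j + 1)).totalDegree_le.trans (by omega)

theorem spherePoly_zero {n : ℕ} (γ : ℝ) (p : MvPolynomial (Fin n) ℝ) :
    spherePoly γ 0 p = p := by
  simp [spherePoly, extCoeff]

theorem spherePoly_ne_zero {n : ℕ} (γ : ℝ) {ℓ : ℕ} {p : MvPolynomial (Fin n) ℝ}
    (hp : p.IsHomogeneous ℓ) (h0 : p ≠ 0) : spherePoly γ ℓ p ≠ 0 := by
  rcases Nat.eq_zero_or_pos ℓ with rfl | hℓ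
  · rwa [spherePoly_zero]
  · intro h
    have h1 := totalDegree_spherePoly_sub_lt γ hℓ hp
    rw [h, zero_sub, totalDegree_neg, hp.totalDegree h0] at h1
    exact lt_irrefl _ h1

open Classical in
/-- The coefficient polynomials of the extension of `p` in powers of `x_N`. -/
noncomputable def sliceCoeff {n : ℕ} (γ : ℝ) (ℓ : ℕ) (p : MvPolynomial (Fin n) ℝ) (k : ℕ) :
    MvPolynomial (Fin n) ℝ :=
  if k ≤ ℓ ∧ Even (ℓ - k) then
    ∑ j ∈ Finset.range (ℓ + 1), C (extCoeff n γ ℓ j * (j.choose ((ℓ - k) / 2) : ℝ)) *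
      (polyNormSq (Fin n) ^ (j - (ℓ - k) / 2) * (polyLaplacian (Fin n) ^ j) p)
  else 0

theorem sliceCoeff_isHomogeneous {n : ℕ} (γ : ℝ) {ℓ : ℕ} {p : MvPolynomial (Fin n) ℝ}
    (hp : p.IsHomogeneous ℓ) (k : ℕ) : (sliceCoeff γ ℓ p k).IsHomogeneous k := by
  unfold sliceCoeff
  split_ifs with h
  · obtain ⟨hk, m, hm⟩ := h
    have hm2 : (ℓ - k) / 2 = m := by omega
    rw [hm2]
    refine IsHomogeneous.sum _ _ _ fun j _ => ?_
    by_cases hj : ℓ < 2 * j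
    · rw [polyLaplacian_pow_eq_zero hp hj]
      simpa using isHomogeneous_zero _ _ _
    · by_cases hjm : j < m
      · rw [Nat.choose_eq_zero_of_lt hjm]
        simpa using isHomogeneous_zero _ _ _
      · have h := (isHomogeneous_C (Fin n) (extCoeff n γ ℓ j * (j.choose m : ℝ))).mul
          (((polyNormSq_isHomogeneous (σ := Fin n)).pow (j - m)).mul
            (polyLaplacian_pow_isHomogeneous hp j))
        rwa [show 0 + (2 * (j - m) + (ℓ - 2 * j)) = k by omega] at h
  · exact isHomogeneous_zero _ _ _

/-- Binomial expansion of (|x̄|² + x_N²)^j, collecting the coefficient of x_N^{2m}; its degree in x̄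
is k = ℓ - 2m. -/
theorem extPoly_eq_homogeneousSum {n : ℕ} (γ : ℝ) {ℓ : ℕ} {p : MvPolynomial (Fin n) ℝ}
    (hp : p.IsHomogeneous ℓ) {x : E n} (hx : x ∈ upperHalf n) :
    lastCoord x ^ (2 * γ) * eval (x : Fin (n + 1) → ℝ) (extPoly γ ℓ p)
      = homogeneousSum γ ℓ (sliceCoeff γ ℓ p) x := by
  have hx0 : 0 < lastCoord x := hx
  set t := lastCoord x ^ 2
  set r := ∑ i, initCoord x i ^ 2
  have hsum : homogeneousSum γ ℓ (sliceCoeff γ ℓ p) x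
      = ∑ m ∈ Finset.range (ℓ / 2 + 1), lastCoord x ^ (2 * (γ + (m : ℝ)))
        * eval (initCoord x) (sliceCoeff γ ℓ p (ℓ - 2 * m)) := by
    unfold homogeneousSum
    symm
    refine Finset.sum_bij (fun m _ => (ℓ - 2 * m, m)) ?_ ?_ ?_ ?_
    · intro m hm
      simp only [Finset.mem_range, Finset.mem_filter, Finset.mem_product] at hm ⊢
      omega
    · intro a _ b _ h
      simpa using congrArg Prod.snd h
    · rintro ⟨k, m⟩ h
      simp only [Finset.mem_range, Finset.mem_filter, Finset.mem_product] at h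
      refine ⟨m, by simp only [Finset.mem_range]; omega, ?_⟩
      simp only [Prod.mk.injEq, and_true]; omega
    · intro m _; rfl
  have hslice : ∀ m ∈ Finset.range (ℓ / 2 + 1), eval (initCoord x) (sliceCoeff γ ℓ p (ℓ - 2 * m))
      = ∑ j ∈ Finset.range (ℓ + 1), extCoeff n γ ℓ j * (j.choose m : ℝ) *
        (r ^ (j - m) * eval (initCoord x) ((polyLaplacian (Fin n) ^ j) p)) := by
    intro m hm
    rw [Finset.mem_range] at hm
    have h1 : ℓ - (ℓ - 2 * m) = 2 * m := by omega
    rw [sliceCoeff, if_pos ⟨Nat.sub_le _ _, by rw [h1]; exact even_two_mul m⟩, h1,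
      Nat.mul_div_cancel_left m two_pos]
    simp [polyNormSq, r]
  have hpow : ∀ m : ℕ, lastCoord x ^ (2 * (γ + (m : ℝ))) = lastCoord x ^ (2 * γ) * t ^ m := by
    intro m
    rw [mul_add, Real.rpow_add hx0, show (2 * (m : ℝ)) = ((2 * m : ℕ) : ℝ) by push_cast; ring,
      Real.rpow_natCast, pow_mul]
  rw [hsum, Finset.sum_congr rfl fun m hm => by rw [hslice m hm, hpow m]]
  simp only [mul_assoc, ← Finset.mul_sum]
  congr 1
  simp only [Finset.mul_sum]
  rw [Finset.sum_comm, eval_extPoly]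
  refine Finset.sum_congr rfl fun j _ => ?_
  by_cases hj : ℓ < 2 * j
  · simp [polyLaplacian_pow_eq_zero hp hj]
  · rw [norm_sq_eq_init_add_last, add_comm, add_pow, Finset.sum_mul, Finset.mul_sum]
    -- The binomial sum stops at m = j ≤ ℓ/2; the terms with j < m ≤ ℓ/2 vanish with their binomial
    -- coefficient.
    refine Finset.sum_subset_zero_on_sdiff (Finset.range_mono (by omega)) ?_ ?_
    · intro m hm
      simp only [Finset.mem_sdiff, Finset.mem_range] at hm
      rw [Nat.choose_eq_zero_of_lt (by omega)]
      simp
    · intro m _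
      ring

end Polynomial

/-! ### The weighted measure -/

instance instIsFiniteMeasure_hemiMeasure (n : ℕ) : IsFiniteMeasure (hemiMeasure n) := by
  unfold hemiMeasure; infer_instance

theorem ae_hemiMeasure_mem (n : ℕ) : ∀ᵐ θ ∂(hemiMeasure n), θ ∈ hemisphere n :=
  ae_restrict_mem (isOpen_hemisphere n).measurableSet

@[fun_prop]
theorem measurable_lastCoord_rpow {n : ℕ} (a : ℝ) :
    Measurable (fun θ : Sph n => lastCoord (θ : E n) ^ a) :=
  (measurable_lastCoord.comp measurable_subtype_coe).pow_const a

/-- The weight is positive on the open hemisphere, so the two measures have the same null sets. -/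
theorem ae_weightedMeasure_iff {n : ℕ} (γ : ℝ) {P : Sph n → Prop} :
    (∀ᵐ θ ∂(weightedMeasure n γ), P θ) ↔ ∀ᵐ θ ∂(hemiMeasure n), P θ := by
  rw [weightedMeasure, ae_withDensity_iff (by fun_prop)]
  refine ⟨fun h => ?_, fun h => h.mono fun θ hθ _ => hθ⟩
  filter_upwards [h, ae_hemiMeasure_mem n] with θ hθ hmem
  exact hθ (by simpa using Real.rpow_pos_of_pos hmem _)

theorem integral_weightedMeasure {n : ℕ} (γ : ℝ) (f : Sph n → ℝ) :
    ∫ θ, f θ ∂(weightedMeasure n γ)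
      = ∫ θ, lastCoord (θ : E n) ^ (1 - 2 * γ) * f θ ∂(hemiMeasure n) := by
  rw [weightedMeasure, integral_withDensity_eq_integral_toReal_smul (by fun_prop) (by simp)]
  refine integral_congr_ae ?_
  filter_upwards [ae_hemiMeasure_mem n] with θ hθ
  rw [ENNReal.toReal_ofReal (Real.rpow_nonneg (le_of_lt hθ) _), smul_eq_mul]

theorem integrable_weightedMeasure_iff {n : ℕ} (γ : ℝ) (f : Sph n → ℝ) :
    Integrable f (weightedMeasure n γ)
      ↔ Integrable (fun θ : Sph n => lastCoord (θ : E n) ^ (1 - 2 * γ) * f θ) (hemiMeasure n) := by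
  rw [weightedMeasure, integrable_withDensity_iff_integrable_smul' (by fun_prop) (by simp)]
  refine integrable_congr ?_
  filter_upwards [ae_hemiMeasure_mem n] with θ hθ
  rw [ENNReal.toReal_ofReal (Real.rpow_nonneg (le_of_lt hθ) _), smul_eq_mul]

theorem integrable_rpow_weightedMeasure {n : ℕ} {γ a : ℝ} (ha : -1 < a + (1 - 2 * γ)) :
    Integrable (fun θ : Sph n => lastCoord (θ : E n) ^ a) (weightedMeasure n γ) := by
  rw [integrable_weightedMeasure_iff]
  refine (integrable_lastCoord_rpow ha).congr ?_
  filter_upwards [ae_hemiMeasure_mem n] with θ hθ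
  rw [add_comm a, Real.rpow_add hθ]

theorem memLp_weightedMeasure_of_bound {n : ℕ} {F : Type*} [NormedAddCommGroup F] {γ a C : ℝ}
    (ha : -1 < 2 * a + (1 - 2 * γ)) {f : Sph n → F}
    (hf : AEStronglyMeasurable f (weightedMeasure n γ))
    (hb : ∀ θ ∈ hemisphere n, ‖f θ‖ ≤ C * lastCoord (θ : E n) ^ a) :
    MemLp f 2 (weightedMeasure n γ) := by
  rw [memLp_two_iff_integrable_sq_norm hf]
  refine ((integrable_rpow_weightedMeasure (n := n) ha).const_mul (C ^ 2)).mono'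
    (hf.norm.pow 2) ?_
  rw [ae_weightedMeasure_iff]
  filter_upwards [ae_hemiMeasure_mem n] with θ hθ
  rw [Real.norm_of_nonneg (sq_nonneg _), two_mul, Real.rpow_add hθ]
  calc ‖f θ‖ ^ 2 ≤ (C * lastCoord (θ : E n) ^ a) ^ 2 :=
        pow_le_pow_left₀ (norm_nonneg _) (hb θ hθ) 2
    _ = _ := by ring

/-- Dominated convergence in the form needed for cutoffs: at each point the error is eventually
zero, and the condition on a makes the majorant square integrable. -/
theorem tendsto_eLpNorm_weightedMeasure_zero {n : ℕ} {F : Type*} [NormedAddCommGroup F]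
    {γ a C : ℝ} (ha : -1 < 2 * a + (1 - 2 * γ)) {f : ℕ → Sph n → F}
    (hf : ∀ j, AEStronglyMeasurable (f j) (weightedMeasure n γ))
    (hb : ∀ j, ∀ θ ∈ hemisphere n, ‖f j θ‖ ≤ C * lastCoord (θ : E n) ^ a)
    (hlim : ∀ θ ∈ hemisphere n, ∀ᶠ j in atTop, f j θ = 0) :
    Tendsto (fun j => eLpNorm (f j) 2 (weightedMeasure n γ)) atTop (𝓝 0) := by
  have h1 : Tendsto (fun j => ∫⁻ θ, ‖f j θ‖ₑ ^ (2 : ℝ) ∂(weightedMeasure n γ)) atTop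
      (𝓝 (∫⁻ _, 0 ∂(weightedMeasure n γ))) := by
    refine tendsto_lintegral_of_dominated_convergence'
      (fun θ => ENNReal.ofReal (C ^ 2 * lastCoord (θ : E n) ^ (2 * a)))
      (fun j => (hf j).enorm.pow_const _) ?_ ?_ ?_
    · intro j
      rw [Filter.EventuallyLE, ae_weightedMeasure_iff]
      filter_upwards [ae_hemiMeasure_mem n] with θ hθ
      rw [← ofReal_norm, ENNReal.ofReal_rpow_of_nonneg (norm_nonneg _) (by norm_num),
        two_mul a, Real.rpow_add hθ]
      refine ENNReal.ofReal_le_ofReal ?_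
      rw [Real.rpow_two]
      calc ‖f j θ‖ ^ 2 ≤ (C * lastCoord (θ : E n) ^ a) ^ 2 :=
            pow_le_pow_left₀ (norm_nonneg _) (hb j θ hθ) 2
        _ = _ := by ring
    · exact ((integrable_rpow_weightedMeasure (n := n) ha).const_mul (C ^ 2)).lintegral_lt_top.ne
    · rw [ae_weightedMeasure_iff]
      filter_upwards [ae_hemiMeasure_mem n] with θ hθ
      refine tendsto_const_nhds.congr' ?_
      filter_upwards [hlim θ hθ] with j hj
      simp [hj]
  rw [lintegral_zero] at h1
  have h2 := (ENNReal.continuous_rpow_const (y := 1 / 2)).tendsto 0 |>.comp h1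
  rw [ENNReal.zero_rpow_of_pos (by norm_num)] at h2
  refine h2.congr fun j => ?_
  rw [eLpNorm_eq_lintegral_rpow_enorm_toReal two_ne_zero ENNReal.ofNat_ne_top]
  simp

/-! ### Calculus of polynomials on Euclidean space -/

theorem contDiff_eval {n : ℕ} {k : WithTop ℕ∞} (F : MvPolynomial (Fin (n + 1)) ℝ) :
    ContDiff ℝ k (fun x : E n => MvPolynomial.eval (x : Fin (n + 1) → ℝ) F) := by
  induction F using MvPolynomial.induction_on with
  | C a => simpa using contDiff_const
  | add p q hp hq => simpa using hp.add hq
  | mul_X p i hp =>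
    have : ContDiff ℝ k (fun x : E n => x i) := by fun_prop
    simpa using hp.mul this

/-- The polynomial vector field with given components. -/
noncomputable def polyField {n : ℕ} (V : Fin (n + 1) → MvPolynomial (Fin (n + 1)) ℝ) (x : E n) :
    E n :=
  WithLp.toLp 2 fun i => MvPolynomial.eval (x : Fin (n + 1) → ℝ) (V i)

theorem polyField_apply {n : ℕ} (V : Fin (n + 1) → MvPolynomial (Fin (n + 1)) ℝ) (x : E n)
    (i : Fin (n + 1)) : polyField V x i = MvPolynomial.eval (x : Fin (n + 1) → ℝ) (V i) := rfl

theorem contDiff_polyField {n : ℕ} {k : WithTop ℕ∞}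
    (V : Fin (n + 1) → MvPolynomial (Fin (n + 1)) ℝ) : ContDiff ℝ k (polyField V) := by
  rw [contDiff_euclidean]
  exact fun i => contDiff_eval (V i)

theorem hasFDerivAt_eval {n : ℕ} (F : MvPolynomial (Fin (n + 1)) ℝ) (x : E n) :
    HasFDerivAt (fun x : E n => MvPolynomial.eval (x : Fin (n + 1) → ℝ) F)
      (innerSL ℝ (polyField (fun i => MvPolynomial.pderiv i F) x)) x := by
  have key : ∀ v : E n, innerSL ℝ (polyField (fun i => MvPolynomial.pderiv i F) x) v
      = ∑ i, v i * MvPolynomial.eval (x : Fin (n + 1) → ℝ) (MvPolynomial.pderiv i F) := by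
    intro v
    simp [PiLp.inner_apply, polyField_apply]
  have main : HasFDerivAt (fun x : E n => MvPolynomial.eval (x : Fin (n + 1) → ℝ) F)
      (∑ i, MvPolynomial.eval (x : Fin (n + 1) → ℝ) (MvPolynomial.pderiv i F) •
        (EuclideanSpace.proj i : E n →L[ℝ] ℝ)) x := by
    clear key
    induction F using MvPolynomial.induction_on with
    | C a => simpa using hasFDerivAt_const a x
    | add p q hp hq =>
      simp only [map_add, add_smul, Finset.sum_add_distrib]
      exact hp.add hq
    | mul_X p j hp =>
      have hj : HasFDerivAt (fun x : E n => x j) (EuclideanSpace.proj j : E n →L[ℝ] ℝ) x :=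
        (EuclideanSpace.proj j : E n →L[ℝ] ℝ).hasFDerivAt
      have h := hp.mul hj
      simp only [map_mul, MvPolynomial.eval_X]
      refine h.congr_fderiv (ContinuousLinearMap.ext fun v => ?_)
      simp only [add_apply, smul_apply, smul_eq_mul, MvPolynomial.pderiv_mul,
        map_add, map_mul, MvPolynomial.eval_X, add_smul, Finset.sum_add_distrib,
        sum_apply, MvPolynomial.pderiv_X, Pi.single_apply]
      rw [add_comm]
      congr 1
      · rw [Finset.mul_sum]
        refine Finset.sum_congr rfl fun i _ => by ring
      · rw [Finset.sum_eq_single j]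
        · simp
        · intro i _ hi; simp [hi.symm]
        · simp
  refine main.congr_fderiv (ContinuousLinearMap.ext fun v => ?_)
  rw [key]
  simp [mul_comm]

theorem fderiv_polyField_apply {n : ℕ} (V : Fin (n + 1) → MvPolynomial (Fin (n + 1)) ℝ)
    (x v : E n) (i : Fin (n + 1)) : fderiv ℝ (polyField V) x v i
      = inner ℝ (polyField (fun j => MvPolynomial.pderiv j (V i)) x) v := by
  have h1 : DifferentiableAt ℝ (polyField V) x :=
    (contDiff_polyField (k := 1) V).differentiable one_ne_zero x
  have h2 := ((EuclideanSpace.proj i : E n →L[ℝ] ℝ).hasFDerivAt (x := polyField V x)).comp x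
    h1.hasFDerivAt
  have h3 := HasFDerivAt.unique h2 (hasFDerivAt_eval (V i) x)
  simpa using congrArg (fun L : E n →L[ℝ] ℝ => L v) h3

theorem euclDiv_polyField {n : ℕ} (V : Fin (n + 1) → MvPolynomial (Fin (n + 1)) ℝ) (x : E n) :
    euclDiv (polyField V) x
      = MvPolynomial.eval (x : Fin (n + 1) → ℝ) (∑ i, MvPolynomial.pderiv i (V i)) := by
  simp [euclDiv, fderiv_polyField_apply, EuclideanSpace.inner_single_right, polyField_apply]

theorem inner_polyField_self {n : ℕ} (V : Fin (n + 1) → MvPolynomial (Fin (n + 1)) ℝ) (x : E n) :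
    inner ℝ (polyField V x) x
      = MvPolynomial.eval (x : Fin (n + 1) → ℝ) (∑ i, MvPolynomial.X i * V i) := by
  simp [PiLp.inner_apply, polyField_apply]

theorem sphereDiv_polyField {n : ℕ} (V : Fin (n + 1) → MvPolynomial (Fin (n + 1)) ℝ) (x : E n) :
    sphereDiv (polyField V) x = MvPolynomial.eval (x : Fin (n + 1) → ℝ)
      (∑ i, MvPolynomial.pderiv i (V i)
        - ∑ i, MvPolynomial.X i * ∑ j, MvPolynomial.X j * MvPolynomial.pderiv j (V i)) := by
  rw [sphereDiv, euclDiv_polyField, map_sub]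
  congr 1
  rw [PiLp.inner_apply]
  simp only [fderiv_polyField_apply, inner_polyField_self]
  simp

/-! ### The extension solution and its flux -/

open MvPolynomial in
/-- The polynomial vector field `x_N^{1-2γ} ∇(x_N^{2γ} F) = 2γ F e_N + x_N ∇F`. -/
noncomputable def fluxPoly {n : ℕ} (γ : ℝ) (F : MvPolynomial (Fin (n + 1)) ℝ)
    (i : Fin (n + 1)) : MvPolynomial (Fin (n + 1)) ℝ :=
  (if i = Fin.last n then C (2 * γ) * F else 0) + X (Fin.last n) * pderiv i F

open MvPolynomial in
/-- The part of the flux tangent to the sphere. -/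
noncomputable def tangentFluxPoly {n : ℕ} (γ : ℝ) (ℓ : ℕ) (F : MvPolynomial (Fin (n + 1)) ℝ)
    (i : Fin (n + 1)) : MvPolynomial (Fin (n + 1)) ℝ :=
  fluxPoly γ F i - C (ℓ + 2 * γ) * X (Fin.last n) * F * X i

-- Euler's identity for U = x_N^{2γ} F, homogeneous of degree ℓ + 2γ, multiplied by x_N^{1-2γ}.
open MvPolynomial in
theorem sum_X_mul_fluxPoly {n : ℕ} (γ : ℝ) {ℓ : ℕ} {F : MvPolynomial (Fin (n + 1)) ℝ}
    (hF : F.IsHomogeneous ℓ) :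
    ∑ i, X i * fluxPoly γ F i = C (ℓ + 2 * γ) * X (Fin.last n) * F := by
  simp only [fluxPoly, mul_add, Finset.sum_add_distrib, mul_ite, mul_zero, Finset.sum_ite_eq',
    Finset.mem_univ, if_true, mul_left_comm _ (X (Fin.last n)), ← Finset.mul_sum,
    sum_X_mul_pderiv_eq hF]
  simp only [map_add, map_mul]
  ring

open MvPolynomial in
theorem fluxPoly_isHomogeneous {n : ℕ} (γ : ℝ) {ℓ : ℕ} {F : MvPolynomial (Fin (n + 1)) ℝ}
    (hF : F.IsHomogeneous ℓ) (i : Fin (n + 1)) : (fluxPoly γ F i).IsHomogeneous ℓ := by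
  refine IsHomogeneous.add ?_ ?_
  · split_ifs
    · simpa using (isHomogeneous_C (Fin (n + 1)) (2 * γ)).mul hF
    · exact isHomogeneous_zero _ _ _
  · rcases Nat.eq_zero_or_pos ℓ with rfl | hℓ
    · rw [totalDegree_eq_zero_iff_eq_C.mp (Nat.le_zero.mp hF.totalDegree_le), pderiv_C, mul_zero]
      exact isHomogeneous_zero _ _ _
    · have := (isHomogeneous_X ℝ (Fin.last n)).mul (hF.pderiv (i := i))
      rwa [show 1 + (ℓ - 1) = ℓ by omega] at this

-- This turns the weighted Laplace equation for x_N^{2γ} F into the polynomial equation solved by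
-- `extPoly`.
open MvPolynomial in
theorem sum_pderiv_fluxPoly {n : ℕ} (γ : ℝ) (F : MvPolynomial (Fin (n + 1)) ℝ) :
    ∑ i, pderiv i (fluxPoly γ F i)
      = X (Fin.last n) * polyLaplacian (Fin (n + 1)) F + C (1 + 2 * γ) * pderiv (Fin.last n) F := by
  have h : ∀ i : Fin (n + 1), pderiv i (fluxPoly γ F i)
      = (if i = Fin.last n then C (1 + 2 * γ) * pderiv (Fin.last n) F else 0)
        + X (Fin.last n) * pderiv i (pderiv i F) := by
    intro i
    by_cases hi : i = Fin.last n
    · subst hi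
      simp only [fluxPoly, if_true, map_add, pderiv_mul, pderiv_C, pderiv_X_self, map_one]
      ring
    · simp only [fluxPoly, if_neg hi, map_add, pderiv_mul, map_zero,
        pderiv_X_of_ne (Ne.symm hi)]
      ring
  simp only [h, Finset.sum_add_distrib, Finset.sum_ite_eq', Finset.mem_univ, if_true,
    ← Finset.mul_sum, polyLaplacian_apply]
  ring

theorem sum_X_mul_sub_mul_X {σ : Type*} [Fintype σ] (a : σ → MvPolynomial σ ℝ)
    (P : MvPolynomial σ ℝ) :
    ∑ i, MvPolynomial.X i * (a i - P * MvPolynomial.X i)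
      = ∑ i, MvPolynomial.X i * a i - P * polyNormSq σ := by
  rw [polyNormSq, Finset.mul_sum, ← Finset.sum_sub_distrib]
  refine Finset.sum_congr rfl fun i _ => ?_
  ring

section Extension

variable {n : ℕ} (γ : ℝ) {ℓ : ℕ} {F : MvPolynomial (Fin (n + 1)) ℝ}

theorem inner_tangentFlux (hF : F.IsHomogeneous ℓ) (θ : Sph n) :
    inner ℝ (polyField (tangentFluxPoly γ ℓ F) θ) (θ : E n) = 0 := by
  have h := sum_X_mul_sub_mul_X (fluxPoly γ F)
    (MvPolynomial.C (ℓ + 2 * γ) * MvPolynomial.X (Fin.last n) * F)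
  rw [sum_X_mul_fluxPoly γ hF] at h
  rw [inner_polyField_self]
  unfold tangentFluxPoly
  rw [h, map_sub, map_mul _ _ (polyNormSq _), eval_polyNormSq, norm_eq_of_mem_sphere]
  ring

/-- Write the tangential flux as V - P x, with V the divergence-free flux of degree ℓ and P = (ℓ+2γ)
x_N F of degree ℓ+1. Its Euclidean divergence is -(ℓ+n+2) P, and by Euler's identity the radial
contribution to the trace is ℓP - (ℓ+2)P = -2P on the sphere. The difference is -(ℓ+n) P. -/
theorem sphereDiv_tangentFlux (hF : F.IsHomogeneous ℓ)
    (heq : MvPolynomial.X (Fin.last n) * polyLaplacian (Fin (n + 1)) F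
      + MvPolynomial.C (1 + 2 * γ) * MvPolynomial.pderiv (Fin.last n) F = 0) (θ : Sph n) :
    sphereDiv (polyField (tangentFluxPoly γ ℓ F)) θ
      = - ((ℓ + 2 * γ) * (ℓ + n)) *
        (lastCoord (θ : E n) * MvPolynomial.eval ((θ : E n) : Fin (n + 1) → ℝ) F) := by
  open MvPolynomial in
  set P : MvPolynomial (Fin (n + 1)) ℝ := C (ℓ + 2 * γ) * X (Fin.last n) * F with hP
  have hPh : P.IsHomogeneous (ℓ + 1) := by
    have := ((isHomogeneous_C (Fin (n + 1)) (ℓ + 2 * γ)).mul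
      (isHomogeneous_X ℝ (Fin.last n))).mul hF
    rwa [show 0 + 1 + ℓ = ℓ + 1 by omega] at this
  have hT : ∀ i, tangentFluxPoly γ ℓ F i = fluxPoly γ F i - P * X i := fun i => rfl
  have h1 : ∑ i, pderiv i (tangentFluxPoly γ ℓ F i) = - (C (ℓ + n + 2 : ℝ) * P) := by
    have e : ∀ i, pderiv i (tangentFluxPoly γ ℓ F i)
        = pderiv i (fluxPoly γ F i) - (X i * pderiv i P + P) := by
      intro i
      rw [hT, map_sub, pderiv_mul, pderiv_X_self]
      ring
    rw [Finset.sum_congr rfl fun i _ => e i, Finset.sum_sub_distrib, Finset.sum_add_distrib,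
      sum_pderiv_fluxPoly, heq, sum_X_mul_pderiv_eq hPh, Finset.sum_const, Finset.card_univ,
      Fintype.card_fin, nsmul_eq_mul]
    simp only [map_add, map_natCast, map_ofNat, Nat.cast_add, Nat.cast_one, map_one]
    ring
  have h2 : ∀ i, ∑ j, X j * pderiv j (tangentFluxPoly γ ℓ F i)
      = C (ℓ : ℝ) * fluxPoly γ F i - C (ℓ + 2 : ℝ) * P * X i := by
    intro i
    rw [hT]
    simp only [map_sub, mul_sub]
    rw [Finset.sum_sub_distrib, sum_X_mul_pderiv_eq (fluxPoly_isHomogeneous γ hF i),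
      sum_X_mul_pderiv_eq (hPh.mul (isHomogeneous_X ℝ i))]
    simp only [map_add, map_natCast, map_ofNat, Nat.cast_add, Nat.cast_one, map_one]
    ring
  have h3 : ∑ i, X i * ∑ j, X j * pderiv j (tangentFluxPoly γ ℓ F i)
      = C (ℓ : ℝ) * P - C (ℓ + 2 : ℝ) * P * polyNormSq (Fin (n + 1)) := by
    rw [Finset.sum_congr rfl fun i _ => by rw [h2 i], sum_X_mul_sub_mul_X]
    congr 1
    rw [hP, ← sum_X_mul_fluxPoly γ hF, Finset.mul_sum]
    exact Finset.sum_congr rfl fun i _ => mul_left_comm _ _ _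
  rw [sphereDiv_polyField, h1, h3]
  simp only [map_sub, map_neg, map_mul, eval_polyNormSq, eval_C, hP, eval_X, lastCoord,
    norm_eq_of_mem_sphere]
  ring

end Extension

/-! ### The extension solution -/

section ExtensionSolution

variable {n : ℕ} {γ : ℝ} {ℓ : ℕ} {F : MvPolynomial (Fin (n + 1)) ℝ}

/-- The function `x_N^{2γ} F(x)`. -/
noncomputable def extSol (γ : ℝ) (F : MvPolynomial (Fin (n + 1)) ℝ) (x : E n) : ℝ :=
  lastCoord x ^ (2 * γ) * MvPolynomial.eval (x : Fin (n + 1) → ℝ) F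

theorem continuous_extSol (hγ : 0 < γ) : Continuous (extSol γ F) :=
  (continuous_lastCoord.rpow_const fun _ => Or.inr (by linarith)).mul
    (contDiff_eval (k := 0) F).continuous

theorem contDiffOn_extSol : ContDiffOn ℝ ∞ (extSol γ F) (upperHalf n) := by
  intro x hx
  refine ContDiffAt.contDiffWithinAt ?_
  exact (contDiff_lastCoord.contDiffAt.rpow_const_of_ne (ne_of_gt hx)).mul
    (contDiff_eval F).contDiffAt

theorem hasFDerivAt_lastCoord (x : E n) :
    HasFDerivAt (lastCoord : E n → ℝ) (EuclideanSpace.proj (Fin.last n) : E n →L[ℝ] ℝ) x :=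
  (EuclideanSpace.proj (Fin.last n) : E n →L[ℝ] ℝ).hasFDerivAt

theorem polyField_fluxPoly (x : E n) :
    polyField (fluxPoly γ F) x = (2 * γ * MvPolynomial.eval (x : Fin (n + 1) → ℝ) F) •
        EuclideanSpace.single (Fin.last n) (1 : ℝ)
      + lastCoord x • polyField (fun i => MvPolynomial.pderiv i F) x := by
  ext i
  simp only [polyField_apply, fluxPoly, map_add, PiLp.add_apply, PiLp.smul_apply, smul_eq_mul,
    map_mul, MvPolynomial.eval_X, lastCoord, PiLp.single_apply]
  split_ifs <;> simp

theorem hasFDerivAt_extSol {x : E n} (hx : x ∈ upperHalf n) :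
    HasFDerivAt (extSol γ F)
      (innerSL ℝ (lastCoord x ^ (2 * γ - 1) • polyField (fluxPoly γ F) x)) x := by
  have hx0 : 0 < lastCoord x := hx
  have h1 := (hasFDerivAt_lastCoord x).rpow_const (p := 2 * γ) (Or.inl hx0.ne')
  have h : HasFDerivAt (extSol γ F) _ x := h1.mul (hasFDerivAt_eval F x)
  refine h.congr_fderiv (ContinuousLinearMap.ext fun v => ?_)
  have h2 : lastCoord x ^ (2 * γ) = lastCoord x ^ (2 * γ - 1) * lastCoord x := by
    rw [← Real.rpow_add_one hx0.ne']; ring_nf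
  rw [polyField_fluxPoly]
  simp only [add_apply, smul_apply, smul_eq_mul, innerSL_apply_apply, inner_smul_left,
    inner_add_left, EuclideanSpace.inner_single_left, h2]
  simp
  ring

theorem gradient_eq_of_hasFDerivAt {f : E n → ℝ} {g x : E n} (h : HasFDerivAt f (innerSL ℝ g) x) :
    gradient f x = g :=
  HasGradientAt.gradient (hasGradientAt_iff_hasFDerivAt.mpr h)

theorem hasFDerivAt_innerSL_gradient {f : E n → ℝ} {x : E n} (h : DifferentiableAt ℝ f x) :
    HasFDerivAt f (innerSL ℝ (gradient f x)) x :=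
  hasGradientAt_iff_hasFDerivAt.mp h.hasGradientAt

theorem inner_gradient {f : E n → ℝ} {x : E n} (h : DifferentiableAt ℝ f x) (v : E n) :
    inner ℝ (gradient f x) v = fderiv ℝ f x v := by
  rw [(hasFDerivAt_innerSL_gradient h).fderiv]; rfl

theorem isExtensionSolution_extSol (hγ : 0 < γ)
    (heq : MvPolynomial.X (Fin.last n) * polyLaplacian (Fin (n + 1)) F
      + MvPolynomial.C (1 + 2 * γ) * MvPolynomial.pderiv (Fin.last n) F = 0) :
    IsExtensionSolution γ (extSol γ F) where
  smooth := contDiffOn_extSol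
  continuous := (continuous_extSol hγ).continuousOn
  equation x hx := by
    have h : (fun y => (lastCoord y ^ (1 - 2 * γ)) • gradient (extSol γ F) y)
        =ᶠ[𝓝 x] polyField (fluxPoly γ F) := by
      filter_upwards [(isOpen_upperHalf n).mem_nhds hx] with y hy
      rw [gradient_eq_of_hasFDerivAt (hasFDerivAt_extSol hy), smul_smul, ← Real.rpow_add hy]
      simp
    rw [euclDiv, h.fderiv_eq]
    have := euclDiv_polyField (fluxPoly γ F) x
    rw [euclDiv] at this
    rw [this, sum_pderiv_fluxPoly, heq]
    simp
  boundary x hx := by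
    rw [extSol, hx, Real.zero_rpow (by linarith), zero_mul]

/-- The gradient on the sphere of `extSol`. -/
noncomputable def extGrad (γ : ℝ) (ℓ : ℕ) (F : MvPolynomial (Fin (n + 1)) ℝ) (θ : Sph n) : E n :=
  lastCoord (θ : E n) ^ (2 * γ - 1) • polyField (tangentFluxPoly γ ℓ F) θ

theorem polyField_tangentFlux (hF : F.IsHomogeneous ℓ) (x : E n) :
    polyField (tangentFluxPoly γ ℓ F) x
      = polyField (fluxPoly γ F) x - (inner ℝ (polyField (fluxPoly γ F) x) x) • x := by
  rw [inner_polyField_self, sum_X_mul_fluxPoly γ hF]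
  ext i
  simp [polyField_apply, tangentFluxPoly]

theorem sphereGrad_extSol (hF : F.IsHomogeneous ℓ) {θ : Sph n} (hθ : θ ∈ hemisphere n) :
    sphereGrad (extSol γ F) θ = extGrad γ ℓ F θ := by
  rw [sphereGrad, gradient_eq_of_hasFDerivAt (hasFDerivAt_extSol hθ), extGrad,
    polyField_tangentFlux hF, inner_smul_left, smul_sub, smul_smul]
  rfl

theorem contDiff_smul_of_tsupport_subset {F' : Type*} [NormedAddCommGroup F'] [NormedSpace ℝ F']
    {f : E n → ℝ} {g : E n → F'} (hf : ContDiffOn ℝ ∞ f (upperHalf n)) (hg : ContDiff ℝ ∞ g)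
    (hs : tsupport g ⊆ upperHalf n) : ContDiff ℝ ∞ (fun x => f x • g x) := by
  rw [contDiff_iff_contDiffAt]
  intro x
  by_cases hx : x ∈ upperHalf n
  · exact ((hf x hx).contDiffAt ((isOpen_upperHalf n).mem_nhds hx)).smul hg.contDiffAt
  · have h := notMem_tsupport_iff_eventuallyEq.mp fun h => hx (hs h)
    refine (contDiffAt_const (c := (0 : F'))).congr_of_eventuallyEq ?_
    filter_upwards [h] with y hy
    rw [hy, Pi.zero_apply, smul_zero]

theorem IsTestField.smul {f : E n → ℝ} {X : E n → E n} (hX : IsTestField X)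
    (hf : ContDiffOn ℝ ∞ f (upperHalf n)) : IsTestField (fun x => f x • X x) where
  smooth := contDiff_smul_of_tsupport_subset hf hX.smooth hX.support
  compact := hX.compact.mono (Function.support_smul_subset_right f X)
  support := (tsupport_smul_subset_right f X).trans hX.support
  tangent θ := by rw [inner_smul_left, hX.tangent θ, mul_zero]

theorem IsTestFunction.smul {φ : E n → ℝ} (hφ : IsTestFunction φ) {X : E n → E n}
    (hX : ContDiff ℝ ∞ X) (ht : ∀ θ : Sph n, inner ℝ (X θ) (θ : E n) = 0) :
    IsTestField (fun x => φ x • X x) where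
  smooth := hφ.smooth.smul hX
  compact := hφ.compact.mono (Function.support_smul_subset_left φ X)
  support := (tsupport_smul_subset_left φ X).trans hφ.support
  tangent θ := by rw [inner_smul_left, ht θ, mul_zero]

theorem continuous_sphereDiv {X : E n → E n} (hX : ContDiff ℝ ∞ X) : Continuous (sphereDiv X) := by
  have h : Continuous (fderiv ℝ X) := hX.continuous_fderiv (by simp)
  unfold sphereDiv euclDiv
  fun_prop

theorem integrable_hemiMeasure_of_continuous {f : E n → ℝ} (hf : Continuous f) :
    Integrable (fun θ : Sph n => f θ) (hemiMeasure n) :=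
  (hf.comp continuous_subtype_val).integrable_of_hasCompactSupport
    (HasCompactSupport.of_compactSpace _)

/-- The divergence theorem applied to U X. This is a smooth test field although U need not be smooth
at the equator, because X is supported in the open half-space. -/
theorem isWeakGradient_extSol (hγ : 0 < γ) (hF : F.IsHomogeneous ℓ) :
    IsWeakGradient (fun θ : Sph n => extSol γ F θ) (extGrad γ ℓ F) where
  tangent := Eventually.of_forall fun θ => by
    rw [extGrad, inner_smul_left, inner_tangentFlux γ hF, mul_zero]
  byParts X hX := by
    have hUX := hX.smul (contDiffOn_extSol (γ := γ) (F := F))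
    have h0 := hUX.integral_sphereDiv_eq_zero
    have hi1 := integrable_hemiMeasure_of_continuous (continuous_sphereDiv hUX.smooth)
    have hi2 := integrable_hemiMeasure_of_continuous (f := fun x => extSol γ F x * sphereDiv X x)
      ((continuous_extSol (F := F) hγ).mul (continuous_sphereDiv hX.smooth))
    have h1 : ∫ θ, inner ℝ (extGrad γ ℓ F θ) (X θ) ∂(hemiMeasure n)
        = ∫ θ : Sph n, (sphereDiv (fun x => extSol γ F x • X x) θ
          - extSol γ F θ * sphereDiv X θ) ∂(hemiMeasure n) := by
      refine integral_congr_ae ?_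
      filter_upwards [ae_hemiMeasure_mem n] with θ hθ
      have hd := hasFDerivAt_extSol (γ := γ) (F := F) (x := θ) hθ
      rw [sphereDiv_smul hd.differentiableAt (hX.smooth.differentiable (by simp) _)
        (hX.tangent θ), hd.fderiv, extGrad, polyField_tangentFlux hF]
      simp only [innerSL_apply_apply, inner_smul_left, inner_sub_left, real_inner_comm (X θ) θ,
        hX.tangent θ]
      simp
    rw [h1, integral_sub hi1 hi2, h0, zero_sub]

theorem inner_sphereGrad_of_tangent {φ : E n → ℝ} {x v : E n} (hφ : DifferentiableAt ℝ φ x)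
    (hv : inner ℝ v x = 0) : inner ℝ v (sphereGrad φ x) = fderiv ℝ φ x v := by
  rw [sphereGrad, inner_sub_right, inner_smul_right, hv, mul_zero, sub_zero, real_inner_comm,
    inner_gradient hφ]

/-- The weight cancels the singular factor of the gradient and leaves a polynomial tangential field
Z; the divergence theorem for φ Z is the weak equation. -/
theorem weak_equation_extSol (hF : F.IsHomogeneous ℓ)
    (heq : MvPolynomial.X (Fin.last n) * polyLaplacian (Fin (n + 1)) F
      + MvPolynomial.C (1 + 2 * γ) * MvPolynomial.pderiv (Fin.last n) F = 0)
    {φ : E n → ℝ} (hφ : IsTestFunction φ) :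
    ∫ θ : Sph n, inner ℝ (extGrad γ ℓ F θ) (sphereGrad φ θ) ∂(weightedMeasure n γ)
      = ((ℓ : ℝ) + 2 * γ) * ((ℓ : ℝ) + (n : ℝ)) *
        ∫ θ : Sph n, extSol γ F θ * φ θ ∂(weightedMeasure n γ) := by
  set Z := polyField (tangentFluxPoly γ ℓ F)
  have hZ : ContDiff ℝ ∞ Z := contDiff_polyField _
  have hX : IsTestField (fun x => φ x • Z x) := hφ.smul hZ (inner_tangentFlux γ hF)
  have h0 := hX.integral_sphereDiv_eq_zero
  have hi1 := integrable_hemiMeasure_of_continuous (continuous_sphereDiv hX.smooth)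
  have hi2 := integrable_hemiMeasure_of_continuous (n := n)
    (f := fun x => lastCoord x * MvPolynomial.eval (x : Fin (n + 1) → ℝ) F * φ x)
    ((continuous_lastCoord.mul (contDiff_eval (k := 0) F).continuous).mul hφ.smooth.continuous)
  rw [integral_weightedMeasure, integral_weightedMeasure, ← integral_const_mul]
  have h1 : ∫ θ : Sph n, lastCoord (θ : E n) ^ (1 - 2 * γ) *
        inner ℝ (extGrad γ ℓ F θ) (sphereGrad φ θ) ∂(hemiMeasure n)
      = ∫ θ : Sph n, (sphereDiv (fun x => φ x • Z x) θ + ((ℓ : ℝ) + 2 * γ) * ((ℓ : ℝ) + (n : ℝ)) *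
        (lastCoord (θ : E n) * MvPolynomial.eval ((θ : E n) : Fin (n + 1) → ℝ) F * φ θ))
        ∂(hemiMeasure n) := by
    refine integral_congr_ae ?_
    filter_upwards [ae_hemiMeasure_mem n] with θ hθ
    have hθ0 : 0 < lastCoord (θ : E n) := hθ
    have hφd : DifferentiableAt ℝ φ θ := hφ.smooth.differentiable (by simp) _
    rw [sphereDiv_smul hφd (hZ.differentiable (by simp) _) (inner_tangentFlux γ hF θ),
      sphereDiv_tangentFlux γ hF heq, extGrad, inner_smul_left,
      inner_sphereGrad_of_tangent hφd (inner_tangentFlux γ hF θ), ← mul_assoc]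
    simp only [conj_trivial]
    rw [← Real.rpow_add hθ0]
    simp only [sub_add_sub_cancel, sub_self, Real.rpow_zero, one_mul]
    ring
  rw [h1, integral_add hi1 (hi2.const_mul _), h0, zero_add]
  refine integral_congr_ae ?_
  filter_upwards [ae_hemiMeasure_mem n] with θ hθ
  have hθ0 : 0 < lastCoord (θ : E n) := hθ
  have h2 : lastCoord (θ : E n) ^ (1 - 2 * γ) * lastCoord (θ : E n) ^ (2 * γ)
      = lastCoord (θ : E n) := by
    rw [← Real.rpow_add hθ0]; simp
  simp only [extSol]
  linear_combination -(((ℓ : ℝ) + 2 * γ) * ((ℓ : ℝ) + (n : ℝ)) *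
    MvPolynomial.eval ((θ : E n) : Fin (n + 1) → ℝ) F * φ θ) * h2

end ExtensionSolution

/-! ### Membership of the extension solutions in the Sobolev space -/

section Sobolev

variable {n : ℕ} {γ : ℝ} {ℓ : ℕ} {F : MvPolynomial (Fin (n + 1)) ℝ}

theorem exists_bound_sphere {F' : Type*} [NormedAddCommGroup F'] {f : E n → F'}
    (hf : Continuous f) : ∃ C, 0 ≤ C ∧ ∀ θ : Sph n, ‖f θ‖ ≤ C := by
  obtain ⟨C, hC⟩ := (isCompact_sphere (0 : E n) 1).exists_bound_of_continuousOn hf.continuousOn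
  exact ⟨max C 0, le_max_right _ _, fun θ => (hC θ θ.2).trans (le_max_left _ _)⟩

theorem measurable_extGrad : Measurable (extGrad γ ℓ F) :=
  (measurable_lastCoord_rpow _).smul
    ((contDiff_polyField (k := 0) _).continuous.comp continuous_subtype_val).measurable

theorem exists_bound_extGrad (γ : ℝ) (ℓ : ℕ) (F : MvPolynomial (Fin (n + 1)) ℝ) :
    ∃ C, 0 ≤ C ∧ ∀ θ ∈ hemisphere n,
      ‖extGrad γ ℓ F θ‖ ≤ C * lastCoord (θ : E n) ^ (2 * γ - 1) := by
  obtain ⟨C, hC0, hC⟩ := exists_bound_sphere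
    (contDiff_polyField (k := 0) (tangentFluxPoly γ ℓ F)).continuous
  refine ⟨C, hC0, fun θ hθ => ?_⟩
  have h := Real.rpow_nonneg (le_of_lt hθ) (2 * γ - 1)
  rw [extGrad, norm_smul, Real.norm_of_nonneg h, mul_comm]
  exact mul_le_mul_of_nonneg_right (hC θ) h

theorem exists_bound_extSol (γ : ℝ) (F : MvPolynomial (Fin (n + 1)) ℝ) :
    ∃ C, 0 ≤ C ∧ ∀ θ ∈ hemisphere n,
      ‖extSol γ F θ‖ ≤ C * lastCoord (θ : E n) ^ (2 * γ) := by
  obtain ⟨C, hC0, hC⟩ := exists_bound_sphere (contDiff_eval (k := 0) F).continuous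
  refine ⟨C, hC0, fun θ hθ => ?_⟩
  have h := Real.rpow_nonneg (le_of_lt hθ) (2 * γ)
  rw [extSol, norm_mul, Real.norm_of_nonneg h, mul_comm]
  exact mul_le_mul_of_nonneg_right (hC θ) h

theorem aestronglyMeasurable_extSol (hγ : 0 < γ) (μ : Measure (Sph n)) :
    AEStronglyMeasurable (fun θ : Sph n => extSol γ F θ) μ :=
  ((continuous_extSol hγ).comp continuous_subtype_val).aestronglyMeasurable

theorem memLp_extSol (hγ : 0 < γ) :
    MemLp (fun θ : Sph n => extSol γ F θ) 2 (weightedMeasure n γ) := by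
  obtain ⟨C, -, hC⟩ := exists_bound_extSol γ F
  exact memLp_weightedMeasure_of_bound (a := 2 * γ) (by linarith)
    (aestronglyMeasurable_extSol hγ _) hC

/-- The squared gradient times the weight is at most a constant times θ_N^{2γ-1}, which is
integrable because γ > 0. -/
theorem memLp_extGrad (hγ : 0 < γ) : MemLp (extGrad γ ℓ F) 2 (weightedMeasure n γ) := by
  obtain ⟨C, -, hC⟩ := exists_bound_extGrad γ ℓ F
  exact memLp_weightedMeasure_of_bound (a := 2 * γ - 1) (by linarith)
    measurable_extGrad.aestronglyMeasurable hC

theorem deriv_smoothTransition_eq_zero {s : ℝ} (hs : s < 0 ∨ 1 < s) :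
    deriv Real.smoothTransition s = 0 := by
  rcases hs with hs | hs
  · have : Real.smoothTransition =ᶠ[𝓝 s] fun _ => 0 := by
      filter_upwards [Iio_mem_nhds hs] with t ht
      exact Real.smoothTransition.zero_of_nonpos (le_of_lt ht)
    rw [this.deriv_eq, deriv_const]
  · have : Real.smoothTransition =ᶠ[𝓝 s] fun _ => 1 := by
      filter_upwards [Ioi_mem_nhds hs] with t ht
      exact Real.smoothTransition.one_of_one_le (le_of_lt ht)
    rw [this.deriv_eq, deriv_const]

theorem exists_bound_deriv_smoothTransition :
    ∃ C, 0 ≤ C ∧ ∀ s, |deriv Real.smoothTransition s| ≤ C := by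
  have hc : Continuous (deriv Real.smoothTransition) :=
    (Real.smoothTransition.contDiff (n := 1)).continuous_deriv le_rfl
  obtain ⟨C, hC⟩ := (isCompact_Icc (a := (0 : ℝ)) (b := 1)).exists_bound_of_continuousOn
    hc.continuousOn
  refine ⟨max C 0, le_max_right _ _, fun s => ?_⟩
  by_cases hs : s ∈ Icc (0 : ℝ) 1
  · exact (hC s hs).trans (le_max_left _ _)
  · rw [deriv_smoothTransition_eq_zero, abs_zero]
    · exact le_max_right _ _
    · by_contra h
      push Not at h
      exact hs h

/-- A smooth cutoff, equal to `1` on the ball of radius `2` and vanishing outside that of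
radius `3`. -/
noncomputable def ballCutoff (n : ℕ) : ContDiffBump (0 : E n) :=
  ⟨2, 3, by norm_num, by norm_num⟩

/-- A smooth cutoff in the last coordinate, vanishing for `x_N ≤ 1/(j+1)` and equal to `1` for
`x_N ≥ 2/(j+1)`. -/
noncomputable def heightCutoff {n : ℕ} (j : ℕ) (x : E n) : ℝ :=
  Real.smoothTransition ((j + 1) * lastCoord x - 1)

theorem contDiff_heightCutoff (j : ℕ) : ContDiff ℝ ∞ (heightCutoff j : E n → ℝ) :=
  Real.smoothTransition.contDiff.comp
    ((contDiff_const.mul contDiff_lastCoord).sub contDiff_const)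

theorem hasFDerivAt_heightCutoff (j : ℕ) (x : E n) :
    HasFDerivAt (heightCutoff j : E n → ℝ)
      (innerSL ℝ ((deriv Real.smoothTransition ((j + 1) * lastCoord x - 1) * (j + 1)) •
        EuclideanSpace.single (Fin.last n) (1 : ℝ))) x := by
  have h1 := ((hasFDerivAt_lastCoord x).const_mul ((j : ℝ) + 1)).sub_const 1
  have h2 := ((Real.smoothTransition.contDiff (n := 1)).differentiable one_ne_zero
    ((j + 1) * lastCoord x - 1)).hasDerivAt.comp_hasFDerivAt x h1
  have h3 : HasFDerivAt (heightCutoff j : E n → ℝ) _ x := h2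
  refine h3.congr_fderiv (ContinuousLinearMap.ext fun v => ?_)
  simp [EuclideanSpace.inner_single_left]
  ring

/-- The approximation of `extSol` by test functions. -/
noncomputable def extApprox (γ : ℝ) (F : MvPolynomial (Fin (n + 1)) ℝ) (j : ℕ) (x : E n) : ℝ :=
  extSol γ F x • (heightCutoff j x * ballCutoff n x)

theorem isTestFunction_extApprox (j : ℕ) : IsTestFunction (extApprox γ F j) := by
  have hsupp : tsupport (fun x : E n => heightCutoff j x * ballCutoff n x) ⊆ upperHalf n := by
    have hclosed : IsClosed {x : E n | 1 ≤ ((j : ℝ) + 1) * lastCoord x} :=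
      isClosed_le continuous_const (by fun_prop)
    refine (closure_minimal (fun x hx => ?_) hclosed).trans fun x hx => ?_
    · by_contra h
      refine hx ?_
      have h' : ((j : ℝ) + 1) * lastCoord x < 1 := not_le.mp h
      simp only [heightCutoff]
      rw [Real.smoothTransition.zero_of_nonpos (by linarith), zero_mul]
    · have h1 : 1 ≤ ((j : ℝ) + 1) * lastCoord x := hx
      have h2 : (0 : ℝ) < (j : ℝ) + 1 := by positivity
      exact (mul_pos_iff_of_pos_left h2).mp (by linarith)
  refine ⟨?_, ?_, (tsupport_smul_subset_right _ _).trans hsupp⟩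
  · exact contDiff_smul_of_tsupport_subset contDiffOn_extSol
      ((contDiff_heightCutoff j).mul (ballCutoff n).contDiff) hsupp
  · refine (ballCutoff n).hasCompactSupport.mono fun x hx => ?_
    contrapose! hx
    simp only [Function.mem_support, not_not] at hx ⊢
    simp [extApprox, hx]

/-- The ball cutoff is identically 1 near the sphere: it only makes the support compact and does not
affect the gradients there. -/
theorem extApprox_eventuallyEq (j : ℕ) (θ : Sph n) :
    extApprox γ F j =ᶠ[𝓝 (θ : E n)] fun x => extSol γ F x * heightCutoff j x := by
  have : (θ : E n) ∈ ball (0 : E n) 2 := by simp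
  filter_upwards [isOpen_ball.mem_nhds this] with x hx
  have : ballCutoff n x = 1 := (ballCutoff n).one_of_mem_closedBall (ball_subset_closedBall hx)
  rw [extApprox, this, mul_one, smul_eq_mul]

theorem sphereGrad_extApprox (hF : F.IsHomogeneous ℓ) (j : ℕ) {θ : Sph n} (hθ : θ ∈ hemisphere n) :
    sphereGrad (extApprox γ F j) θ = heightCutoff j (θ : E n) • extGrad γ ℓ F θ
      + (extSol γ F θ *
        (deriv Real.smoothTransition ((j + 1) * lastCoord (θ : E n) - 1) * (j + 1))) •
        sphereGrad lastCoord (θ : E n) := by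
  set c := deriv Real.smoothTransition ((j + 1) * lastCoord (θ : E n) - 1) * (j + 1)
  have hU := hasFDerivAt_extSol (γ := γ) (F := F) hθ
  have h1 := (hU.mul (hasFDerivAt_heightCutoff j (θ : E n))).congr_of_eventuallyEq
    (extApprox_eventuallyEq (γ := γ) (F := F) j θ)
  have h2 : gradient (extApprox γ F j) (θ : E n)
      = heightCutoff j (θ : E n) • gradient (extSol γ F) θ + (extSol γ F θ * c) •
        EuclideanSpace.single (Fin.last n) (1 : ℝ) := by
    rw [gradient_eq_of_hasFDerivAt hU]
    refine gradient_eq_of_hasFDerivAt (h1.congr_fderiv (ContinuousLinearMap.ext fun v => ?_))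
    simp only [add_apply, smul_apply, innerSL_apply_apply, inner_add_left, inner_smul_left,
      smul_eq_mul, conj_trivial, c]
    ring
  have h3 : gradient (lastCoord : E n → ℝ) (θ : E n)
      = EuclideanSpace.single (Fin.last n) (1 : ℝ) := by
    refine gradient_eq_of_hasFDerivAt ((hasFDerivAt_lastCoord _).congr_fderiv ?_)
    refine ContinuousLinearMap.ext fun v => ?_
    simp [EuclideanSpace.inner_single_left]
  rw [← sphereGrad_extSol hF hθ]
  simp only [sphereGrad, h2, h3, inner_add_left, inner_smul_left, conj_trivial]
  module

theorem continuous_sphereGrad {f : E n → ℝ} (hf : ContDiff ℝ ∞ f) : Continuous (sphereGrad f) := by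
  have h : Continuous (gradient f) :=
    (InnerProductSpace.toDual ℝ (E n)).symm.continuous.comp (hf.continuous_fderiv (by simp))
  unfold sphereGrad
  fun_prop

theorem aestronglyMeasurable_of_continuous {F' : Type*} [NormedAddCommGroup F'] {f : E n → F'}
    (hf : Continuous f) (μ : Measure (Sph n)) : AEStronglyMeasurable (fun θ : Sph n => f θ) μ :=
  (hf.comp continuous_subtype_val).aestronglyMeasurable

theorem eventually_one_lt_height {t : ℝ} (ht : 0 < t) :
    ∀ᶠ j : ℕ in atTop, 1 < ((j : ℝ) + 1) * t - 1 := by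
  filter_upwards [eventually_gt_atTop ⌈2 / t⌉₊] with j hj
  have h1 : 2 / t < j := Nat.lt_of_ceil_lt hj
  rw [div_lt_iff₀ ht] at h1
  linarith

theorem tendsto_extApprox (hγ : 0 < γ) :
    Tendsto (fun j => eLpNorm (fun θ : Sph n => extApprox γ F j θ - extSol γ F θ) 2
      (weightedMeasure n γ)) atTop (𝓝 0) := by
  obtain ⟨C, hC0, hC⟩ := exists_bound_extSol γ F
  have heq : ∀ j (θ : Sph n), extApprox γ F j θ - extSol γ F θ
      = (heightCutoff j (θ : E n) - 1) * extSol γ F θ := fun j θ => by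
    rw [(extApprox_eventuallyEq j θ).self_of_nhds]; ring
  refine tendsto_eLpNorm_weightedMeasure_zero (a := 2 * γ) (C := C) (by linarith)
    (fun j => (aestronglyMeasurable_of_continuous
      (isTestFunction_extApprox j).smooth.continuous _).sub (aestronglyMeasurable_extSol hγ _))
    (fun j θ hθ => ?_) fun θ hθ => ?_
  · rw [heq, norm_mul]
    refine (mul_le_of_le_one_left (norm_nonneg _) ?_).trans (hC θ hθ)
    have h0 := Real.smoothTransition.nonneg ((j + 1) * lastCoord (θ : E n) - 1)
    have h1 := Real.smoothTransition.le_one ((j + 1) * lastCoord (θ : E n) - 1)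
    rw [Real.norm_eq_abs, abs_le, heightCutoff]
    constructor <;> linarith
  · filter_upwards [eventually_one_lt_height hθ] with j hj
    rw [heq, heightCutoff, Real.smoothTransition.one_of_one_le hj.le]
    ring

/-- The derivative of the height cutoff has size at most B (j+1) and vanishes where (j+1) θ_N > 2,
so it is at most 2B/θ_N. Times |U| ≤ C θ_N^{2γ} this gives a bound of order θ_N^{2γ-1}, uniform in j
and of the same kind as for the gradient of U. -/
theorem tendsto_sphereGrad_extApprox (hγ : 0 < γ) (hF : F.IsHomogeneous ℓ) :
    Tendsto (fun j => eLpNorm (fun θ : Sph n =>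
      sphereGrad (extApprox γ F j) θ - extGrad γ ℓ F θ) 2 (weightedMeasure n γ)) atTop (𝓝 0) := by
  obtain ⟨C, hC0, hC⟩ := exists_bound_extSol γ F
  obtain ⟨D, hD0, hD⟩ := exists_bound_extGrad γ ℓ F
  obtain ⟨B, hB0, hB⟩ := exists_bound_deriv_smoothTransition
  obtain ⟨T, hT0, hT⟩ := exists_bound_sphere (continuous_sphereGrad (contDiff_lastCoord (n := n)))
  have heq : ∀ j, ∀ θ ∈ hemisphere n, sphereGrad (extApprox γ F j) θ - extGrad γ ℓ F θ
      = (heightCutoff j (θ : E n) - 1) • extGrad γ ℓ F θ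
      + (extSol γ F θ *
        (deriv Real.smoothTransition ((j + 1) * lastCoord (θ : E n) - 1) * (j + 1))) •
        sphereGrad lastCoord (θ : E n) := fun j θ hθ => by
    rw [sphereGrad_extApprox hF j hθ]; module
  refine tendsto_eLpNorm_weightedMeasure_zero (a := 2 * γ - 1) (C := D + 2 * C * B * T)
    (by linarith)
    (fun j => (aestronglyMeasurable_of_continuous
      (continuous_sphereGrad (isTestFunction_extApprox j).smooth) _).sub
      measurable_extGrad.aestronglyMeasurable)
    (fun j θ hθ => ?_) fun θ hθ => ?_
  · have hθ0 : 0 < lastCoord (θ : E n) := hθ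
    have hp : 0 ≤ lastCoord (θ : E n) ^ (2 * γ - 1) := Real.rpow_nonneg hθ0.le _
    rw [heq j θ hθ, add_mul D]
    refine (norm_add_le _ _).trans (add_le_add ?_ ?_)
    · rw [norm_smul]
      refine (mul_le_of_le_one_left (norm_nonneg _) ?_).trans (hD θ hθ)
      have h0 := Real.smoothTransition.nonneg ((j + 1) * lastCoord (θ : E n) - 1)
      have h1 := Real.smoothTransition.le_one ((j + 1) * lastCoord (θ : E n) - 1)
      rw [Real.norm_eq_abs, abs_le, heightCutoff]
      constructor <;> linarith
    · have hj : (0 : ℝ) ≤ (j : ℝ) + 1 := by positivity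
      have h1 : |deriv Real.smoothTransition ((j + 1) * lastCoord (θ : E n) - 1)|
          * (((j : ℝ) + 1) * lastCoord (θ : E n)) ≤ B * 2 := by
        by_cases h : 2 < ((j : ℝ) + 1) * lastCoord (θ : E n)
        · rw [deriv_smoothTransition_eq_zero (Or.inr (by linarith)), abs_zero, zero_mul]
          positivity
        · exact mul_le_mul (hB _) (not_lt.mp h) (by positivity) hB0
      have h2 : lastCoord (θ : E n) ^ (2 * γ)
          = lastCoord (θ : E n) ^ (2 * γ - 1) * lastCoord (θ : E n) := by
        rw [← Real.rpow_add_one hθ0.ne']; ring_nf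
      rw [norm_smul, norm_mul, norm_mul, Real.norm_of_nonneg hj, Real.norm_eq_abs (deriv _ _)]
      calc _ ≤ C * lastCoord (θ : E n) ^ (2 * γ) *
            (|deriv Real.smoothTransition ((j + 1) * lastCoord (θ : E n) - 1)| * ((j : ℝ) + 1)) * T :=
            mul_le_mul (mul_le_mul_of_nonneg_right (hC θ hθ) (by positivity)) (hT θ)
              (norm_nonneg _) (mul_nonneg (mul_nonneg hC0 (Real.rpow_nonneg hθ0.le _))
                (by positivity))
        _ = C * T * lastCoord (θ : E n) ^ (2 * γ - 1) *
            (|deriv Real.smoothTransition ((j + 1) * lastCoord (θ : E n) - 1)|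
            * (((j : ℝ) + 1) * lastCoord (θ : E n))) := by rw [h2]; ring
        _ ≤ C * T * lastCoord (θ : E n) ^ (2 * γ - 1) * (B * 2) :=
            mul_le_mul_of_nonneg_left h1 (by positivity)
        _ = _ := by ring
  · filter_upwards [eventually_one_lt_height hθ] with j hj
    rw [heq j θ hθ, heightCutoff, Real.smoothTransition.one_of_one_le hj.le,
      deriv_smoothTransition_eq_zero (Or.inr hj)]
    simp

theorem memH12Zero_extSol (hγ : 0 < γ) (hF : F.IsHomogeneous ℓ) :
    MemH12Zero γ (fun θ : Sph n => extSol γ F θ) (extGrad γ ℓ F) where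
  memLp := memLp_extSol hγ
  memLp_grad := memLp_extGrad hγ
  weakGrad := isWeakGradient_extSol hγ hF
  approx := ⟨extApprox γ F, isTestFunction_extApprox, tendsto_extApprox hγ,
    tendsto_sphereGrad_extApprox hγ hF⟩

end Sobolev

/-! ### Orthogonality of weak solutions -/

theorem tendsto_integral_inner {α V : Type*} [MeasurableSpace α] {μ : Measure α}
    [NormedAddCommGroup V] [InnerProductSpace ℝ V] {a b : α → V} {f : ℕ → α → V}
    (ha : MemLp a 2 μ) (hb : MemLp b 2 μ) (hf : ∀ j, MemLp (f j) 2 μ)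
    (h : Tendsto (fun j => eLpNorm (fun x => f j x - b x) 2 μ) atTop (𝓝 0)) :
    Tendsto (fun j => ∫ x, inner ℝ (a x) (f j x) ∂μ) atTop (𝓝 (∫ x, inner ℝ (a x) (b x) ∂μ)) := by
  have h1 := (Lp.tendsto_Lp_iff_tendsto_eLpNorm'' f hf b hb).mpr h
  have h2 := (tendsto_const_nhds (x := ha.toLp a)).inner h1 (𝕜 := ℝ)
  have h3 : ∀ {g : α → V} (hg : MemLp g 2 μ),
      inner ℝ (ha.toLp a) (hg.toLp g) = ∫ x, inner ℝ (a x) (g x) ∂μ := by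
    intro g hg
    rw [L2.inner_def]
    refine integral_congr_ae ?_
    filter_upwards [ha.coeFn_toLp, hg.coeFn_toLp] with x hx1 hx2
    rw [hx1, hx2]
  simpa only [h3] using h2

/-- `Y`, with weak gradient `G`, is a weak solution of the weighted eigenvalue equation. -/
structure IsWeakSolution {n : ℕ} (γ lam : ℝ) (Y : Sph n → ℝ) (G : Sph n → E n) : Prop where
  mem : MemH12Zero γ Y G
  equation : ∀ φ : E n → ℝ, IsTestFunction φ →
    ∫ θ : Sph n, inner ℝ (G θ) (sphereGrad φ θ) ∂(weightedMeasure n γ)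
      = lam * ∫ θ : Sph n, Y θ * φ θ ∂(weightedMeasure n γ)

section Pairing

variable {n : ℕ} {γ : ℝ}

/-- For γ < 1 the exponent 1 - 2γ exceeds -1, so the weighted measure is finite and bounded
functions are square integrable. -/
theorem memLp_of_continuous (hγ : γ < 1) {F' : Type*} [NormedAddCommGroup F'] {f : E n → F'}
    (hf : Continuous f) : MemLp (fun θ : Sph n => f θ) 2 (weightedMeasure n γ) := by
  obtain ⟨C, -, hC⟩ := exists_bound_sphere hf
  refine memLp_weightedMeasure_of_bound (a := 0) (C := C) (by linarith)
    (aestronglyMeasurable_of_continuous hf _) fun θ _ => ?_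
  simpa using hC θ

/-- The weak equation extends from test functions to their closure, since both sides are
L²-continuous in the test function and its gradient. -/
theorem IsWeakSolution.integral_inner_grad (hγ : γ < 1) {lam : ℝ} {Y Y' : Sph n → ℝ}
    {G G' : Sph n → E n} (hY : IsWeakSolution γ lam Y G) (hY' : MemH12Zero γ Y' G') :
    ∫ θ, inner ℝ (G θ) (G' θ) ∂(weightedMeasure n γ)
      = lam * ∫ θ, Y θ * Y' θ ∂(weightedMeasure n γ) := by
  obtain ⟨φ, hφ, h1, h2⟩ := hY'.approx
  have t1 := tendsto_integral_inner hY.mem.memLp_grad hY'.memLp_grad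
    (fun j => memLp_of_continuous hγ (continuous_sphereGrad (hφ j).smooth)) h2
  have t2 := tendsto_integral_inner hY.mem.memLp hY'.memLp
    (fun j => memLp_of_continuous hγ (hφ j).smooth.continuous) h1
  have e : ∀ a b : ℝ, inner ℝ a b = a * b := fun a b => by simp [mul_comm]
  simp only [e] at t2
  refine tendsto_nhds_unique t1 ?_
  simp only [hY.equation _ (hφ _)]
  exact t2.const_mul lam

/-- Symmetry of the Dirichlet form: testing each solution against the other gives λ∫YY' = λ'∫YY'. -/
theorem IsWeakSolution.integral_mul_eq_zero (hγ : γ < 1) {lam lam' : ℝ} {Y Y' : Sph n → ℝ}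
    {G G' : Sph n → E n} (hY : IsWeakSolution γ lam Y G) (hY' : IsWeakSolution γ lam' Y' G')
    (hne : lam ≠ lam') : ∫ θ, Y θ * Y' θ ∂(weightedMeasure n γ) = 0 := by
  have h1 := hY.integral_inner_grad hγ hY'.mem
  have h2 := hY'.integral_inner_grad hγ hY.mem
  simp only [real_inner_comm, mul_comm (Y' _)] at h2
  rw [h1] at h2
  by_contra h
  exact hne (mul_right_cancel₀ h h2)

theorem isWeakSolution_extSol (hγ : 0 < γ) {ℓ : ℕ} {p : MvPolynomial (Fin n) ℝ}
    (hp : p.IsHomogeneous ℓ) :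
    IsWeakSolution γ (((ℓ : ℝ) + 2 * γ) * ((ℓ : ℝ) + (n : ℝ)))
      (fun θ : Sph n => extSol γ (extPoly γ ℓ p) θ) (extGrad γ ℓ (extPoly γ ℓ p)) where
  mem := memH12Zero_extSol hγ (extPoly_isHomogeneous γ hp)
  equation _ hφ := weak_equation_extSol (extPoly_isHomogeneous γ hp) (extPoly_equation hγ hp) hφ

theorem eigenvalue_injective (hn : 1 ≤ n) (hγ : 0 < γ) {ℓ m : ℕ}
    (h : ((ℓ : ℝ) + 2 * γ) * ((ℓ : ℝ) + (n : ℝ)) = ((m : ℝ) + 2 * γ) * ((m : ℝ) + (n : ℝ))) :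
    ℓ = m := by
  have h1 : ((ℓ : ℝ) - m) * (ℓ + m + n + 2 * γ) = 0 := by linear_combination h
  have h2 : (ℓ + m + n + 2 * γ : ℝ) ≠ 0 := by positivity
  have h3 := (mul_eq_zero.mp h1).resolve_right h2
  exact_mod_cast sub_eq_zero.mp h3

end Pairing

/-! ### Density -/

section Density

variable {n : ℕ} {γ : ℝ}

theorem continuous_initCoord_apply (i : Fin n) : Continuous fun x : E n => initCoord x i := by
  unfold initCoord; fun_prop

theorem continuous_eval_initCoord (q : MvPolynomial (Fin n) ℝ) :
    Continuous fun x : E n => MvPolynomial.eval (initCoord x) q := by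
  simp only [← eval_rename_castSucc]
  exact (contDiff_eval (k := 0) _).continuous

/-- Polynomials in `x̄` are uniformly dense in the continuous functions on the closed
hemisphere. -/
theorem exists_polynomial_near (g : Sph n → ℝ) (hg : Continuous g) {ε : ℝ} (hε : 0 < ε) :
    ∃ q : MvPolynomial (Fin n) ℝ, ∀ θ ∈ hemisphere n,
      |MvPolynomial.eval (initCoord (θ : E n)) q - g θ| < ε := by
  let K : Set (Sph n) := {θ | 0 ≤ lastCoord (θ : E n)}
  have hK : IsClosed K :=
    isClosed_le continuous_const (continuous_lastCoord.comp continuous_subtype_val)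
  have : CompactSpace K := isCompact_iff_compactSpace.mp hK.isCompact
  let c : Fin n → C(K, ℝ) := fun i => ⟨fun θ => initCoord (θ.1 : E n) i,
    (continuous_initCoord_apply i).comp (continuous_subtype_val.comp continuous_subtype_val)⟩
  have hc : ∀ (q : MvPolynomial (Fin n) ℝ) (θ : K),
      MvPolynomial.aeval c q θ = MvPolynomial.eval (initCoord (θ.1 : E n)) q := by
    intro q θ
    induction q using MvPolynomial.induction_on with
    | C a => simp
    | add p q hp hq => simp [hp, hq]
    | mul_X p i hp => simp [hp, c]
  -- On the closed upper hemisphere θ_N is the nonnegative root of 1 - |θ̄|², so the coordinates θ̄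
  -- alone separate points.
  have hsep : (MvPolynomial.aeval (R := ℝ) c).range.SeparatesPoints := by
    intro x y hxy
    by_contra hcon
    push Not at hcon
    have hinit : ∀ i, initCoord (x.1 : E n) i = initCoord (y.1 : E n) i := by
      intro i
      have := hcon (c i) ⟨c i, ⟨MvPolynomial.X i, by simp⟩, rfl⟩
      exact this
    have hx := norm_sq_eq_init_add_last (x.1 : E n)
    have hy := norm_sq_eq_init_add_last (y.1 : E n)
    simp only [hinit, norm_eq_of_mem_sphere] at hx hy
    have hlast : lastCoord (x.1 : E n) = lastCoord (y.1 : E n) := by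
      have hx0 : 0 ≤ lastCoord (x.1 : E n) := x.2
      have hy0 : 0 ≤ lastCoord (y.1 : E n) := y.2
      rw [← abs_of_nonneg hx0, ← abs_of_nonneg hy0]
      exact (sq_eq_sq_iff_abs_eq_abs _ _).mp (by linarith)
    refine hxy (Subtype.ext (Subtype.ext ?_))
    ext i
    exact Fin.lastCases hlast hinit i
  obtain ⟨⟨f, q, hq⟩, hf⟩ :=
    ContinuousMap.exists_mem_subalgebra_near_continuous_of_separatesPoints _ hsep
      (fun θ : K => g θ) (hg.comp continuous_subtype_val) ε hε
  refine ⟨q, fun θ hθ => ?_⟩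
  have hθK : θ ∈ K := (show 0 < lastCoord (θ : E n) from hθ).le
  have h1 := hf ⟨θ, hθK⟩
  have hq' : MvPolynomial.aeval c q = f := hq
  rw [← hc q ⟨θ, hθK⟩, hq']
  exact h1

open scoped Manifold in
theorem ae_eq_zero_of_forall_continuous {μ : Measure (Sph n)} {k : Sph n → ℝ}
    (hk : Integrable k μ) (h : ∀ g : Sph n → ℝ, Continuous g → ∫ θ, g θ * k θ ∂μ = 0) :
    ∀ᵐ θ ∂μ, k θ = 0 := by
  have : IsManifold (𝓡 n) ∞ (Sph n) := IsManifold.of_le (n := ω) le_top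
  exact ae_eq_zero_of_integral_contMDiff_smul_eq_zero (𝓡 n) hk.locallyIntegrable
    fun g hg _ => h g hg.continuous

/-- Uniform approximation of a continuous g by polynomials within ε bounds |∫ g k| by ε ∫ |k|, so k
annihilates all continuous functions. -/
theorem ae_eq_zero_of_forall_polynomial {k : Sph n → ℝ} (hk : Integrable k (hemiMeasure n))
    (h : ∀ q : MvPolynomial (Fin n) ℝ,
      ∫ θ : Sph n, MvPolynomial.eval (initCoord (θ : E n)) q * k θ ∂(hemiMeasure n) = 0) :
    ∀ᵐ θ ∂(hemiMeasure n), k θ = 0 := by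
  have hint : ∀ g : Sph n → ℝ, Continuous g →
      Integrable (fun θ => g θ * k θ) (hemiMeasure n) := by
    intro g hg
    obtain ⟨C, hC⟩ := isCompact_univ.exists_bound_of_continuousOn hg.continuousOn
    exact hk.bdd_mul hg.aestronglyMeasurable (Eventually.of_forall fun θ => hC θ (mem_univ _))
  refine ae_eq_zero_of_forall_continuous hk fun g hg => ?_
  have hbound : ∀ ε : ℝ, 0 < ε →
      ‖∫ θ, g θ * k θ ∂(hemiMeasure n)‖ ≤ ε * ∫ θ, ‖k θ‖ ∂(hemiMeasure n) := by
    intro ε hε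
    obtain ⟨q, hq⟩ := exists_polynomial_near g hg hε
    have hqc : Continuous fun θ : Sph n => MvPolynomial.eval (initCoord (θ : E n)) q :=
      (continuous_eval_initCoord q).comp continuous_subtype_val
    have h1 : ∫ θ, g θ * k θ ∂(hemiMeasure n)
        = ∫ θ : Sph n, (g θ * k θ - MvPolynomial.eval (initCoord (θ : E n)) q * k θ)
          ∂(hemiMeasure n) := by
      rw [integral_sub (hint g hg) (hint _ hqc), h q, sub_zero]
    rw [h1, ← integral_const_mul]
    refine norm_integral_le_of_norm_le (hk.norm.const_mul ε) ?_
    filter_upwards [ae_hemiMeasure_mem n] with θ hθ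
    rw [← sub_mul, norm_mul]
    refine mul_le_mul_of_nonneg_right ?_ (norm_nonneg _)
    rw [norm_sub_rev]
    exact (hq θ hθ).le
  have hI : 0 ≤ ∫ θ, ‖k θ‖ ∂(hemiMeasure n) := integral_nonneg fun θ => norm_nonneg _
  have hle : ‖∫ θ, g θ * k θ ∂(hemiMeasure n)‖ ≤ 0 := by
    refine le_of_forall_pos_le_add fun δ hδ => ?_
    refine (hbound (δ / (∫ θ, ‖k θ‖ ∂(hemiMeasure n) + 1)) (by positivity)).trans ?_
    rw [zero_add, div_mul_eq_mul_div, div_le_iff₀ (by positivity)]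
    nlinarith
  exact norm_le_zero_iff.mp hle

/-- The extension solutions are total in the weighted `L²` space. -/
theorem ae_eq_zero_of_forall_extSol (hγ : 0 < γ) {H : Sph n → ℝ}
    (hH : MemLp H 2 (weightedMeasure n γ))
    (h : ∀ (ℓ : ℕ) (p : MvPolynomial (Fin n) ℝ), p.IsHomogeneous ℓ →
      ∫ θ : Sph n, H θ * extSol γ (extPoly γ ℓ p) θ ∂(weightedMeasure n γ) = 0) :
    H =ᵐ[weightedMeasure n γ] 0 := by
  have hpow : ∀ θ ∈ hemisphere n, lastCoord (θ : E n) ^ (1 - 2 * γ) * lastCoord (θ : E n) ^ (2 * γ)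
      = lastCoord (θ : E n) := fun θ hθ => by
    rw [← Real.rpow_add hθ]; simp
  -- The weight times θ_N^{2γ} is θ_N, so weighted orthogonality of H to U is unweighted
  -- orthogonality of θ_N H to the polynomial F.
  have hconv : ∀ F : MvPolynomial (Fin (n + 1)) ℝ,
      (fun θ : Sph n => lastCoord (θ : E n) ^ (1 - 2 * γ) * (H θ * extSol γ F θ))
        =ᵐ[hemiMeasure n] fun θ : Sph n =>
          MvPolynomial.eval ((θ : E n) : Fin (n + 1) → ℝ) F * (lastCoord (θ : E n) * H θ) := by
    intro F
    filter_upwards [ae_hemiMeasure_mem n] with θ hθ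
    simp only [extSol]
    linear_combination (H θ * MvPolynomial.eval ((θ : E n) : Fin (n + 1) → ℝ) F) * hpow θ hθ
  have hint : ∀ F : MvPolynomial (Fin (n + 1)) ℝ, Integrable (fun θ : Sph n =>
      MvPolynomial.eval ((θ : E n) : Fin (n + 1) → ℝ) F * (lastCoord (θ : E n) * H θ))
        (hemiMeasure n) := by
    intro F
    have h1 : Integrable (fun θ : Sph n => H θ * extSol γ F θ) (weightedMeasure n γ) :=
      hH.integrable_mul (memLp_extSol hγ)
    rw [integrable_weightedMeasure_iff] at h1
    exact h1.congr (hconv F)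
  have hintq : ∀ q : MvPolynomial (Fin n) ℝ, Integrable (fun θ : Sph n =>
      MvPolynomial.eval (initCoord (θ : E n)) q * (lastCoord (θ : E n) * H θ))
        (hemiMeasure n) := by
    intro q
    simpa only [eval_rename_castSucc] using hint (MvPolynomial.rename Fin.castSucc q)
  have hk : Integrable (fun θ : Sph n => lastCoord (θ : E n) * H θ) (hemiMeasure n) := by
    simpa using hint 1
  have hsphere : ∀ (ℓ : ℕ) (p : MvPolynomial (Fin n) ℝ), p.IsHomogeneous ℓ →
      ∫ θ : Sph n, MvPolynomial.eval (initCoord (θ : E n)) (spherePoly γ ℓ p) *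
        (lastCoord (θ : E n) * H θ) ∂(hemiMeasure n) = 0 := by
    intro ℓ p hp
    have h1 := h ℓ p hp
    rw [integral_weightedMeasure, integral_congr_ae (hconv _)] at h1
    simpa only [eval_extPoly_sphere] using h1
  let I : MvPolynomial (Fin n) ℝ →ₗ[ℝ] ℝ :=
    { toFun := fun q => ∫ θ : Sph n, MvPolynomial.eval (initCoord (θ : E n)) q *
        (lastCoord (θ : E n) * H θ) ∂(hemiMeasure n)
      map_add' := fun q r => by
        rw [← integral_add (hintq q) (hintq r)]
        simp only [map_add, add_mul]
      map_smul' := fun a q => by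
        rw [RingHom.id_apply, smul_eq_mul, ← integral_const_mul]
        simp only [MvPolynomial.smul_eval, mul_assoc] }
  -- On the sphere the polynomial factor is p plus homogeneous components of degree below ℓ; the
  -- induction hypothesis removes those and leaves `I p = 0`.
  have hhom : ∀ ℓ : ℕ, ∀ p : MvPolynomial (Fin n) ℝ, p.IsHomogeneous ℓ → I p = 0 := by
    intro ℓ
    induction ℓ using Nat.strong_induction_on with
    | _ ℓ ih =>
      intro p hp
      have hs : I (spherePoly γ ℓ p) = 0 := hsphere ℓ p hp
      rcases Nat.eq_zero_or_pos ℓ with rfl | hℓ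
      · rwa [spherePoly_zero] at hs
      · have hlow : I (spherePoly γ ℓ p - p) = 0 := by
          rw [← MvPolynomial.sum_homogeneousComponent (spherePoly γ ℓ p - p), map_sum]
          refine Finset.sum_eq_zero fun i hi => ih i ?_ _
            (MvPolynomial.homogeneousComponent_isHomogeneous i _)
          have := totalDegree_spherePoly_sub_lt γ hℓ hp
          rw [Finset.mem_range] at hi
          omega
        rw [map_sub, hs, zero_sub, neg_eq_zero] at hlow
        exact hlow
  have hall : ∀ q, I q = 0 := fun q => by
    rw [← MvPolynomial.sum_homogeneousComponent q, map_sum]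
    exact Finset.sum_eq_zero fun i _ => hhom i _ (MvPolynomial.homogeneousComponent_isHomogeneous i _)
  have hzero := ae_eq_zero_of_forall_polynomial hk hall
  rw [Filter.EventuallyEq, ae_weightedMeasure_iff]
  filter_upwards [hzero, ae_hemiMeasure_mem n] with θ h1 hθ
  exact (mul_eq_zero.mp h1).resolve_left (ne_of_gt hθ)

end Density

/-! ### The eigenfunctions -/

section Eigenfunctions

variable {n : ℕ} {γ : ℝ}

/-- By continuity, vanishing almost everywhere means vanishing on the whole open hemisphere. Then
`spherePoly` would vanish on an open box of values of x̄, contradicting its nonzero leading part p.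
-/
theorem extSol_ne_zero {ℓ : ℕ} {p : MvPolynomial (Fin n) ℝ} (hγ : 0 < γ)
    (hp : p.IsHomogeneous ℓ) (h0 : p ≠ 0) :
    ¬ ((fun θ : Sph n => extSol γ (extPoly γ ℓ p) θ) =ᵐ[weightedMeasure n γ] 0) := by
  intro h
  rw [Filter.EventuallyEq, ae_weightedMeasure_iff] at h
  have h1 : EqOn (fun θ : Sph n => extSol γ (extPoly γ ℓ p) θ) 0 (hemisphere n) :=
    Measure.eqOn_open_of_ae_eq (μ := (volume : Measure (E n)).toSphere) h (isOpen_hemisphere n)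
      ((continuous_extSol hγ).comp continuous_subtype_val).continuousOn continuousOn_const
  refine spherePoly_ne_zero γ hp h0 ?_
  -- In this box |y|² ≤ n/(n+1) < 1, so every y lifts to the hemisphere point with last coordinate
  -- √(1-|y|²).
  refine MvPolynomial.funext_set (fun _ => Ioo (0 : ℝ) (1 / (n + 1)))
    (fun _ => Ioo_infinite (by positivity)) fun y hy => ?_
  rw [map_zero]
  have hy' : ∀ i, 0 < y i ∧ y i < 1 / (n + 1) := fun i => hy i (mem_univ i)
  have hsum : ∑ i, y i ^ 2 < 1 := by
    have h2 : ∑ i, y i ^ 2 ≤ ∑ _i : Fin n, (1 / (n + 1) : ℝ) := by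
      refine Finset.sum_le_sum fun i _ => ?_
      have h3 : (1 / (n + 1) : ℝ) ≤ 1 := by
        rw [div_le_one (by positivity)]; simp
      nlinarith [hy' i]
    refine h2.trans_lt ?_
    rw [Finset.sum_const, Finset.card_univ, Fintype.card_fin, nsmul_eq_mul, mul_one_div,
      div_lt_one (by positivity)]
    linarith
  let x : E n := WithLp.toLp 2 (Fin.snoc (α := fun _ => ℝ) y (√(1 - ∑ i, y i ^ 2)))
  have hxi : initCoord x = y := by
    ext i; simp [initCoord, x]
  have hxl : lastCoord x = √(1 - ∑ i, y i ^ 2) := by simp [lastCoord, x]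
  have hxn : ‖x‖ = 1 := by
    have h2 := norm_sq_eq_init_add_last x
    rw [hxi, hxl, Real.sq_sqrt (by linarith)] at h2
    have h3 : ‖x‖ ^ 2 = 1 := by linarith
    nlinarith [norm_nonneg x]
  let θ : Sph n := ⟨x, by simpa using hxn⟩
  have hθ : θ ∈ hemisphere n := by
    change 0 < lastCoord x
    rw [hxl]
    exact Real.sqrt_pos.mpr (by linarith)
  have h2 : extSol γ (extPoly γ ℓ p) (θ : E n) = 0 := h1 hθ
  rw [extSol, eval_extPoly_sphere] at h2
  have h3 := (mul_eq_zero.mp h2).resolve_left (Real.rpow_pos_of_pos hθ _).ne'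
  rwa [show initCoord (θ : E n) = y from hxi] at h3

/-- The extension solutions of degree `ℓ` as elements of the weighted `L²` space. -/
noncomputable def extSolLp (n : ℕ) (hγ : 0 < γ) (ℓ : ℕ) :
    MvPolynomial.homogeneousSubmodule (Fin n) ℝ ℓ →ₗ[ℝ] Lp ℝ 2 (weightedMeasure n γ) where
  toFun p := (memLp_extSol (F := extPoly γ ℓ p.1) hγ).toLp _
  map_add' p q := by
    rw [← MemLp.toLp_add]
    congr 1
    ext θ
    simp [extSol, mul_add]
  map_smul' a p := by
    rw [RingHom.id_apply, ← MemLp.toLp_const_smul]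
    congr 1
    ext θ
    simp [extSol]
    ring

theorem inner_toLp_eq_integral {μ : Measure (Sph n)} {a b : Sph n → ℝ} (ha : MemLp a 2 μ)
    (hb : MemLp b 2 μ) : inner ℝ (ha.toLp a) (hb.toLp b) = ∫ θ, b θ * a θ ∂μ := by
  rw [L2.inner_def]
  refine integral_congr_ae ?_
  filter_upwards [ha.coeFn_toLp, hb.coeFn_toLp] with x hx1 hx2
  rw [hx1, hx2]
  simp

/-- The `L²`-projection of a function on the space of extension solutions of degree `ℓ`. -/
theorem exists_extSol_projection (hγ : 0 < γ) (ℓ : ℕ) {Y : Sph n → ℝ}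
    (hY : MemLp Y 2 (weightedMeasure n γ)) :
    ∃ p : MvPolynomial (Fin n) ℝ, p.IsHomogeneous ℓ ∧
      ∀ q : MvPolynomial (Fin n) ℝ, q.IsHomogeneous ℓ →
        ∫ θ : Sph n, (Y θ - extSol γ (extPoly γ ℓ p) θ) * extSol γ (extPoly γ ℓ q) θ
          ∂(weightedMeasure n γ) = 0 := by
  -- Finite dimension of the space of degree-ℓ polynomials, hence of its image in L², ensures that
  -- the orthogonal projection exists.
  have : FiniteDimensional ℝ (MvPolynomial.homogeneousSubmodule (Fin n) ℝ ℓ) :=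
    Submodule.finiteDimensional_of_le (S₂ := MvPolynomial.restrictTotalDegree (Fin n) ℝ ℓ)
      fun p hp => by
        rw [MvPolynomial.mem_restrictTotalDegree]
        exact MvPolynomial.IsHomogeneous.totalDegree_le hp
  obtain ⟨y, ⟨p, rfl⟩, z, hz, hyz⟩ :=
    (LinearMap.range (extSolLp n hγ ℓ)).exists_add_mem_mem_orthogonal (hY.toLp Y)
  refine ⟨p.1, p.2, fun q hq => ?_⟩
  have h1 := hz (extSolLp n hγ ℓ ⟨q, hq⟩) ⟨_, rfl⟩
  rw [eq_sub_of_add_eq' hyz.symm] at h1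
  change inner ℝ ((memLp_extSol hγ).toLp _) (hY.toLp Y - (memLp_extSol hγ).toLp _) = 0 at h1
  rw [← MemLp.toLp_sub, inner_toLp_eq_integral] at h1
  exact h1

/-- Y minus its projection is orthogonal to the explicit solutions of degree ℓ by construction, and
to those of any other degree because the eigenvalues differ. Totality makes it zero. -/
theorem IsWeakSolution.exists_eq_extSol (hn : 1 ≤ n) (hγ : γ ∈ Ioo (0 : ℝ) 1) {ℓ : ℕ}
    {Y : Sph n → ℝ} {G : Sph n → E n}
    (hY : IsWeakSolution γ (((ℓ : ℝ) + 2 * γ) * ((ℓ : ℝ) + (n : ℝ))) Y G) :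
    ∃ p : MvPolynomial (Fin n) ℝ, p.IsHomogeneous ℓ ∧
      Y =ᵐ[weightedMeasure n γ] fun θ : Sph n => extSol γ (extPoly γ ℓ p) θ := by
  obtain ⟨p, hp, horth⟩ := exists_extSol_projection hγ.1 ℓ hY.mem.memLp
  refine ⟨p, hp, ?_⟩
  have hU : MemLp (fun θ : Sph n => extSol γ (extPoly γ ℓ p) θ) 2 (weightedMeasure n γ) :=
    memLp_extSol hγ.1
  have h := ae_eq_zero_of_forall_extSol hγ.1 (hY.mem.memLp.sub hU) fun m q hq => ?_
  · filter_upwards [h] with θ hθ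
    exact sub_eq_zero.mp hθ
  · by_cases hm : ℓ = m
    · subst hm
      exact horth q hq
    · have hne := fun h => hm (eigenvalue_injective (γ := γ) hn hγ.1 h)
      have hq' := isWeakSolution_extSol hγ.1 hq
      have h1 := hY.integral_mul_eq_zero hγ.2 hq' hne
      have h2 := (isWeakSolution_extSol hγ.1 hp).integral_mul_eq_zero hγ.2 hq' hne
      simp only [Pi.sub_apply, sub_mul]
      have i1 : Integrable (fun θ : Sph n => Y θ * extSol γ (extPoly γ m q) θ)
          (weightedMeasure n γ) := hY.mem.memLp.integrable_mul (memLp_extSol hγ.1)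
      have i2 : Integrable (fun θ : Sph n => extSol γ (extPoly γ ℓ p) θ *
          extSol γ (extPoly γ m q) θ) (weightedMeasure n γ) := hU.integrable_mul (memLp_extSol hγ.1)
      rw [integral_sub i1 i2, h1, h2, sub_zero]

theorem IsWeakSolution.eq_zero (hγ : γ ∈ Ioo (0 : ℝ) 1) {lam : ℝ}
    {Y : Sph n → ℝ} {G : Sph n → E n} (hY : IsWeakSolution γ lam Y G)
    (hlam : ∀ ℓ : ℕ, lam ≠ ((ℓ : ℝ) + 2 * γ) * ((ℓ : ℝ) + (n : ℝ))) :
    Y =ᵐ[weightedMeasure n γ] 0 :=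
  ae_eq_zero_of_forall_extSol hγ.1 hY.mem.memLp fun ℓ _ hp =>
    hY.integral_mul_eq_zero hγ.2 (isWeakSolution_extSol hγ.1 hp) (hlam ℓ)

end Eigenfunctions

end WeightedHemisphere

theorem propositionA4 (n : ℕ) (hn : 1 ≤ n) (γ : ℝ) (hγ : γ ∈ Set.Ioo (0 : ℝ) 1) :
    WeightedHemisphere.dirichletSpectrum n γ
      = {lam : ℝ | ∃ ℓ : ℕ, lam = ((ℓ : ℝ) + 2 * γ) * ((ℓ : ℝ) + (n : ℝ))} ∧
    ∀ (ℓ : ℕ) (Y : WeightedHemisphere.Sph n → ℝ),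
      WeightedHemisphere.IsDirichletEigenfunction γ
        (((ℓ : ℝ) + 2 * γ) * ((ℓ : ℝ) + (n : ℝ))) Y →
      ∃ U : WeightedHemisphere.E n → ℝ,
        WeightedHemisphere.IsExtensionSolution γ U ∧
        (∃ p : ℕ → MvPolynomial (Fin n) ℝ, (∀ k, (p k).IsHomogeneous k) ∧
          ∀ x ∈ WeightedHemisphere.upperHalf n,
            U x = WeightedHemisphere.homogeneousSum γ ℓ p x) ∧
        Y =ᵐ[WeightedHemisphere.weightedMeasure n γ]
          fun θ => U (θ : WeightedHemisphere.E n) := by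
  open WeightedHemisphere in
  refine ⟨Set.ext fun lam => ⟨?_, ?_⟩, ?_⟩
  · rintro ⟨Y, hne, G, hmem, heq⟩
    by_contra hcon
    exact hne (IsWeakSolution.eq_zero hγ ⟨hmem, heq⟩ fun ℓ h => hcon ⟨ℓ, h⟩)
  · rintro ⟨ℓ, rfl⟩
    -- Any nonzero homogeneous polynomial of degree ℓ yields an eigenfunction; n ≥ 1 supplies the
    -- variable for this power.
    have hp : (MvPolynomial.X ⟨0, hn⟩ ^ ℓ : MvPolynomial (Fin n) ℝ).IsHomogeneous ℓ := by
      simpa using (MvPolynomial.isHomogeneous_X ℝ (⟨0, hn⟩ : Fin n)).pow ℓ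
    have hsol := isWeakSolution_extSol hγ.1 hp
    exact ⟨_, extSol_ne_zero hγ.1 hp (pow_ne_zero _ (MvPolynomial.X_ne_zero _)), _, hsol.mem,
      hsol.equation⟩
  · rintro ℓ Y ⟨-, G, hmem, heq⟩
    obtain ⟨p, hp, hY⟩ := IsWeakSolution.exists_eq_extSol hn hγ ⟨hmem, heq⟩
    exact ⟨extSol γ (extPoly γ ℓ p), isExtensionSolution_extSol hγ.1 (extPoly_equation hγ.1 hp),
      ⟨sliceCoeff γ ℓ p, sliceCoeff_isHomogeneous γ hp,
        fun x hx => extPoly_eq_homogeneousSum γ hp hx⟩, hY⟩
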